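/- A $3$-graph $H$ consists of a finite vertex set $V(H)$ and a set $E(H)$ of $3$-element subsets of $V(H)$; write $n=|V(H)|$ and $V=V(H)$. The minimum degree $\delta_1(H)$ is the least number of edges containing a given vertex. A copy of a $3$-graph $F$ in $H$ is a (not necessarily induced) subgraph of $H$ isomorphic to $F$, and an $F$-factor in $H$ is a set of pairwise vertex-disjoint copies of $F$ in $H$ that together cover $V(H)$. For real numbers $p\in[0,1]$ and $\mu>0$: - $H$ is $(p,\mu,\mathrm{edge})$-dense if for all $X\subseteq V$ and $Y\subseteq V^2$, the number of pairs $(x,(y_1,y_2))\in X\times Y$ with $\{x,y_1,y_2\}\in E(H)$ is at least $p|X||Y|-\mu n^3$; - $H$ is $(p,\mu,\mathrm{cherry})$-dense if for all $P,Q\subseteq V^2$, with $\mathcal K(P,Q)=\{(x,y,z)\in V^3:(x,y)\in P,\ (y,z)\in Q\}$, the number of $(x,y,z)\in\mathcal K(P,Q)$ with $\{x,y,z\}\in E(H)$ is at least $p|\mathcal K(P,Q)|-\mu n^3$. For $\mathscr S\in\{\mathrm{edge},\mathrm{cherry}\}$, let $\mathbf{FACTOR}_3^{\mathscr S,1}$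 be the class of all $3$-graphs $F$ such that for all $0<p,\alpha<1$ there are $n_0\in\mathbb N$ and $\mu>0$ for which every $(p,\mu,\mathscr S)$-dense $3$-graph $H$ on $n\ge n_0$ vertices, with $|V(F)|$ dividing $n$ and $\delta_1(H)\ge\alpha n^2$, has an $F$-factor. Let $K_4^{(3)-}$ be the $3$-graph with four vertices and exactly three edges. **Theorem 9.3.** $K_4^{(3)-}\in\mathbf{FACTOR}_3^{\mathrm{cherry},1}$. In contrast, $K_4^{(3)-}\notin\mathbf{FACTOR}_3^{\mathrm{edge},1}$. -/

import Mathlib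

/-- A `3`-graph (3-uniform hypergraph) on the vertex set `V`: a family of `3`-element subsets. -/
structure ThreeGraph (V : Type*) where
  /-- The edges. -/
  edges : Finset (Finset V)
  /-- Every edge has exactly three vertices. -/
  card_edge : ∀ e ∈ edges, e.card = 3

namespace ThreeGraph

/-- The degree of a vertex: the number of edges that contain it. -/
def degree {V : Type*} [DecidableEq V] (H : ThreeGraph V) (v : V) : ℕ :=
  (H.edges.filter (fun e => v ∈ e)).card

/-- A copy of `F` in `H` (as a not necessarily induced subgraph): an injective map of vertices
that sends edges of `F` to edges of `H`. -/
structure Copy {W V : Type*} (F : ThreeGraph W) (H : ThreeGraph V) where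
  /-- The embedding of the vertices. -/
  emb : W ↪ V
  /-- Edges go to edges. -/
  map_edge : ∀ e ∈ F.edges, e.map emb ∈ H.edges

/-- The vertex set of a copy. -/
def Copy.vertexSet {W V : Type*} {F : ThreeGraph W} {H : ThreeGraph V} (c : Copy F H) : Set V :=
  Set.range c.emb

/-- `H` has an `F`-factor: there is a set of pairwise vertex-disjoint copies of `F` in `H`
which together cover all vertices of `H`. -/
def HasFactor {W V : Type*} (F : ThreeGraph W) (H : ThreeGraph V) : Prop :=
  ∃ T : Set (Copy F H), T.PairwiseDisjoint Copy.vertexSet ∧ ⋃ c ∈ T, c.vertexSet = Set.univ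

/-- `(p, μ, edge)`-density: for every set `X` of vertices and every set `Y` of ordered pairs,
the number of `(x, (y₁, y₂)) ∈ X × Y` with `{x, y₁, y₂}` an edge is at least
`p |X| |Y| - μ n ^ 3`. -/
def EdgeDense {V : Type*} [Fintype V] [DecidableEq V] (H : ThreeGraph V) (p μ : ℝ) : Prop :=
  ∀ (X : Finset V) (Y : Finset (V × V)),
    p * (X.card : ℝ) * (Y.card : ℝ) - μ * (Fintype.card V : ℝ) ^ 3 ≤
      (((X ×ˢ Y).filter
        (fun t => ({t.1, t.2.1, t.2.2} : Finset V) ∈ H.edges)).card : ℝ)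

/-- The triples `(x, y, z)` with `(x, y) ∈ P` and `(y, z) ∈ Q`. -/
def cherries {V : Type*} [Fintype V] [DecidableEq V] (P Q : Finset (V × V)) :
    Finset (V × V × V) :=
  Finset.univ.filter (fun t => (t.1, t.2.1) ∈ P ∧ (t.2.1, t.2.2) ∈ Q)

/-- `(p, μ, cherry)`-density: for all sets `P`, `Q` of ordered pairs, the number of
`(x, y, z)` with `(x, y) ∈ P`, `(y, z) ∈ Q` and `{x, y, z}` an edge is at least
`p |K(P, Q)| - μ n ^ 3`, where `K(P, Q)` is the set of all `(x, y, z)` with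
`(x, y) ∈ P` and `(y, z) ∈ Q`. -/
def CherryDense {V : Type*} [Fintype V] [DecidableEq V] (H : ThreeGraph V) (p μ : ℝ) : Prop :=
  ∀ P Q : Finset (V × V),
    p * ((cherries P Q).card : ℝ) - μ * (Fintype.card V : ℝ) ^ 3 ≤
      (((cherries P Q).filter
        (fun t => ({t.1, t.2.1, t.2.2} : Finset V) ∈ H.edges)).card : ℝ)

/-- The two quasi-randomness notions compared in the theorem. -/
inductive QuasiNotion where
  | edge
  | cherry

/-- `(p, μ, S)`-density for a quasi-randomness notion `S`. -/
def IsDense {V : Type*} [Fintype V] [DecidableEq V] (H : ThreeGraph V) (p μ : ℝ) :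
    QuasiNotion → Prop
  | .edge => EdgeDense H p μ
  | .cherry => CherryDense H p μ

/-- Membership of the `3`-graph `F` in the class `FACTOR` for uniformity `3`, the notion `S` and
minimum `1`-degree: for all `0 < p, α < 1` there are `n₀` and `μ > 0` such that every
`(p, μ, S)`-dense `3`-graph `H` on `n ≥ n₀` vertices, with `v(F) ∣ n` and minimum degree at
least `α n ^ 2`, has an `F`-factor. -/
def MemFactorClass {W : Type*} [Fintype W] (S : QuasiNotion) (F : ThreeGraph W) : Prop :=
  ∀ p α : ℝ, 0 < p → p < 1 → 0 < α → α < 1 →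
    ∃ (n₀ : ℕ) (μ : ℝ), 0 < μ ∧
      ∀ (V : Type) [Fintype V] [DecidableEq V] (H : ThreeGraph V),
        n₀ ≤ Fintype.card V →
        Fintype.card W ∣ Fintype.card V →
        IsDense H p μ S →
        (∀ v : V, α * (Fintype.card V : ℝ) ^ 2 ≤ (H.degree v : ℝ)) →
        HasFactor F H

/-- The `3`-graph with three edges on four vertices. -/
def K4Minus : ThreeGraph (Fin 4) where
  edges := {{0, 1, 2}, {0, 1, 3}, {0, 2, 3}}
  card_edge := by decide

end ThreeGraph

/-! Cherry density, absorption. Cherries whose middle vertex has a sparse pair of sets in its link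
show that all but `ε n` vertices have a link that is lower-dense between any two vertex sets
(`CherryDense.card_not_linkDense_le`). A triangle in the link of `a` is a copy of `K4Minus` with
apex `a`, so every linear-sized set contains a copy, and by the degree condition every vertex `u`
lies in one: `u` need not be the apex, it suffices that some `y` with a dense link has many
neighbours of `u` in that link.

An edge `t = (a, b, c)` absorbs a vertex `u` when `u` is a common neighbour of `b` and `c` in the
link of `a`. `exists_flexible_triples` picks `m ≈ γ n` disjoint edges and keeps them off a reserve
`R` of about `m / 2` vertices. Each chosen edge absorbs many vertices of `R`, and for every large
`W` few chosen edges absorb only a small part of `W`. A greedy choice controlled by an exponential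
potential over all `W` replaces a random choice. The few vertices absorbed by too few chosen edges
are covered by copies at the outset. Further copies are then removed greedily until exactly `m`
vertices `U` remain, including nearly all of `R`, and Hall's theorem matches the chosen edges with
`U` (`hasFactor_of_flexible`).

Edge density, a construction. The cyclic triangles of an oriented graph contain no `K4Minus`: the
link of a vertex joins only out-neighbours to in-neighbours, so it has no triangle. For the Paley
tournament with `q ≡ 3 mod 4`, each vertex replaced by four copies so that `4` divides `n`, the rows
of the sign matrix are almost orthogonal. Cauchy–Schwarz then gives edge density `1 / 4` with error
`o(n ^ 3)`, and vanishing row sums give quadratic minimum degree. -/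

open Finset

namespace ThreeGraph

/-! ### Edges as a ternary relation -/

section Links

variable {V : Type*} [DecidableEq V]

/-- The vertices `a`, `b`, `c` form an edge. -/
def Adj (H : ThreeGraph V) (a b c : V) : Prop := ({a, b, c} : Finset V) ∈ H.edges

lemma Adj.swap_left {H : ThreeGraph V} {a b c : V} (h : H.Adj a b c) : H.Adj b a c := by
  unfold Adj at *; rwa [Finset.insert_comm]

lemma Adj.distinct {H : ThreeGraph V} {a b c : V} (h : H.Adj a b c) :
    a ≠ b ∧ a ≠ c ∧ b ≠ c := by
  have h3 := H.card_edge _ h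
  refine ⟨?_, ?_, ?_⟩ <;> rintro rfl
  · have := Finset.card_le_two (a := a) (b := c)
    simp at h3; omega
  · have := Finset.card_le_two (a := b) (b := a)
    rw [Finset.insert_comm] at h3
    simp at h3; omega
  · have := Finset.card_le_two (a := a) (b := b)
    simp at h3; omega

end Links

/-! ### Partial factors and copies of `K4Minus` -/

section Tilings

variable {V : Type*}

/-- The set `S` is the vertex set of a family of pairwise disjoint copies of `F`. -/
def Tileable {W : Type*} (F : ThreeGraph W) (H : ThreeGraph V) (S : Set V) : Prop :=
  ∃ T : Set (Copy F H), T.PairwiseDisjoint Copy.vertexSet ∧ ⋃ c ∈ T, c.vertexSet = S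

lemma tileable_empty {W : Type*} (F : ThreeGraph W) (H : ThreeGraph V) : Tileable F H ∅ :=
  ⟨∅, by simp, by simp⟩

lemma Tileable.union {W : Type*} {F : ThreeGraph W} {H : ThreeGraph V} {S S' : Set V}
    (h : Tileable F H S) (h' : Tileable F H S') (hd : Disjoint S S') :
    Tileable F H (S ∪ S') := by
  obtain ⟨T, hT, rfl⟩ := h
  obtain ⟨T', hT', rfl⟩ := h'
  refine ⟨T ∪ T', ?_, Set.biUnion_union _ _ _⟩
  refine hT.union hT' ?_
  intro c hc c' hc' _
  exact hd.mono (Set.subset_biUnion_of_mem hc) (Set.subset_biUnion_of_mem hc')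

lemma tileable_copy {W : Type*} {F : ThreeGraph W} {H : ThreeGraph V} (c : Copy F H) :
    Tileable F H c.vertexSet :=
  ⟨{c}, by simp, by simp⟩

variable [DecidableEq V]

lemma Tileable.of_biUnion {W ι : Type*} [DecidableEq ι] {F : ThreeGraph W} {H : ThreeGraph V}
    (s : Finset ι) (f : ι → Finset V) (h : ∀ i ∈ s, Tileable F H (f i))
    (hd : (s : Set ι).PairwiseDisjoint f) : Tileable F H (s.biUnion f : Finset V) := by
  induction s using Finset.induction_on with
  | empty => simpa using tileable_empty F H
  | insert i s hi ih =>
    rw [Finset.biUnion_insert, Finset.coe_union]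
    refine (h i (by simp)).union
      (ih (fun j hj => h j (by simp [hj])) (hd.subset (by simp))) ?_
    rw [Finset.disjoint_coe, Finset.disjoint_biUnion_right]
    intro j hj
    exact hd (by simp) (by simp [hj]) (by rintro rfl; exact hi hj)

/-- Four vertices spanning a copy of `K4Minus` with apex `a`. -/
def IsK4Minus (H : ThreeGraph V) (a b c d : V) : Prop :=
  H.Adj a b c ∧ H.Adj a b d ∧ H.Adj a c d

lemma IsK4Minus.tileable {H : ThreeGraph V} {a b c d : V} (h : H.IsK4Minus a b c d) :
    Tileable K4Minus H ({a, b, c, d} : Finset V) := by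
  obtain ⟨h1, h2, h3⟩ := h
  have d1 := h1.distinct
  have d2 := h2.distinct
  have d3 := h3.distinct
  have hinj : Function.Injective ![a, b, c, d] := by
    intro i j hij
    fin_cases i <;> fin_cases j <;> simp_all
  let cp : Copy K4Minus H :=
    { emb := ⟨![a, b, c, d], hinj⟩
      map_edge := by
        intro e he
        simp only [K4Minus, Finset.mem_insert, Finset.mem_singleton] at he
        rcases he with rfl | rfl | rfl
        · simpa [Finset.map_insert, Finset.map_singleton, Adj] using h1
        · simpa [Finset.map_insert, Finset.map_singleton, Adj] using h2
        · simpa [Finset.map_insert, Finset.map_singleton, Adj] using h3 }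
  have := tileable_copy cp
  convert this
  simp only [Copy.vertexSet, cp, Function.Embedding.coeFn_mk, Finset.coe_insert,
    Finset.coe_singleton]
  ext x
  simp only [Set.mem_insert_iff, Set.mem_singleton_iff, Set.mem_range, Fin.exists_fin_succ, Matrix.cons_val_zero, Matrix.cons_val_succ, eq_comm (a := x)]
  simp

lemma IsK4Minus.card {H : ThreeGraph V} {a b c d : V} (h : H.IsK4Minus a b c d) :
    ({a, b, c, d} : Finset V).card = 4 := by
  have d1 := h.1.distinct
  have d2 := h.2.1.distinct
  have d3 := h.2.2.distinct
  rw [Finset.card_eq_of_equiv_fin]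
  exact (Fintype.equivFinOfCardEq (by
    rw [Fintype.card_coe, Finset.card_insert_of_notMem, Finset.card_insert_of_notMem,
      Finset.card_pair] <;> simp_all))

end Tilings

/-! ### Dense links and the existence of copies -/

section Counting

variable {V : Type*} [Fintype V] [DecidableEq V]

/-- The link graph of `a` is lower-dense between any two sets of vertices. -/
def LinkDense (H : ThreeGraph V) (p ε : ℝ) (a : V) : Prop :=
  ∀ A B : Finset V, p * (A.card : ℝ) * (B.card : ℝ) - ε * (Fintype.card V : ℝ) ^ 2 ≤
    (((A ×ˢ B).filter (fun t => ({t.1, a, t.2} : Finset V) ∈ H.edges)).card : ℝ)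

-- Each exceptional `a` comes with a sparse pair `A a`, `B a`. Taking `P` to be the pairs from `A a`
-- into `a` and `Q` those from `a` into `B a`, the cherries split by middle vertex, and the deficits
-- add up to at least `|N| ε n ^ 2`, while density allows only `ε ^ 2 n ^ 3`.
open Classical in
lemma CherryDense.card_not_linkDense_le {H : ThreeGraph V} {p ε : ℝ} (hε : 0 < ε)
    (hH : H.CherryDense p (ε ^ 2)) :
    ((univ.filter (fun a => ¬ H.LinkDense p ε a)).card : ℝ) ≤ ε * Fintype.card V := by
  set N := univ.filter (fun a => ¬ H.LinkDense p ε a) with hN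
  have hbad : ∀ a : V, ∃ A B : Finset V, a ∈ N →
      (((A ×ˢ B).filter (fun t => ({t.1, a, t.2} : Finset V) ∈ H.edges)).card : ℝ) ≤
      p * (A.card : ℝ) * (B.card : ℝ) - ε * (Fintype.card V : ℝ) ^ 2 := by
    intro a
    by_cases ha : a ∈ N
    · have := (Finset.mem_filter.mp ha).2
      unfold LinkDense at this
      push Not at this
      obtain ⟨A, B, h⟩ := this
      exact ⟨A, B, fun _ => h.le⟩
    · exact ⟨∅, ∅, fun h => absurd h ha⟩
  choose A B hAB using hbad
  let P : Finset (V × V) := univ.filter (fun t => t.2 ∈ N ∧ t.1 ∈ A t.2)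
  let Q : Finset (V × V) := univ.filter (fun t => t.2 ∈ B t.1)
  -- An arbitrary predicate is allowed so that the same bijection counts both all cherries and those
  -- that span an edge.
  have key : ∀ (X : V → V → V → Prop) [∀ x y z, Decidable (X x y z)],
      ((cherries P Q).filter (fun t => X t.1 t.2.1 t.2.2)).card =
      ∑ a ∈ N, ((A a ×ˢ B a).filter (fun t => X t.1 a t.2)).card := by
    intro X _
    rw [← Finset.card_sigma]
    refine Finset.card_bij' (fun t _ => ⟨t.2.1, (t.1, t.2.2)⟩)
      (fun s _ => (s.2.1, s.1, s.2.2)) ?_ ?_ ?_ ?_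
    · rintro ⟨x, y, z⟩ h
      simp only [cherries, P, Q, Finset.mem_filter, Finset.mem_univ, true_and] at h
      simp only [Finset.mem_sigma, Finset.mem_filter, Finset.mem_product]
      tauto
    · rintro ⟨y, x, z⟩ h
      simp only [Finset.mem_sigma, Finset.mem_filter, Finset.mem_product] at h
      simp only [cherries, P, Q, Finset.mem_filter, Finset.mem_univ, true_and]
      tauto
    · intros; rfl
    · intros; rfl
  have h1 := hH P Q
  have k1 := key (fun x y z => ({x, y, z} : Finset V) ∈ H.edges)
  have k2 := key (fun _ _ _ => True)
  simp only [Finset.filter_true, Finset.card_product] at k2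
  rw [k1, k2] at h1
  push_cast at h1
  have h2 := Finset.sum_le_sum hAB
  rw [Finset.sum_sub_distrib, Finset.sum_const, nsmul_eq_mul] at h2
  simp only [mul_assoc] at h2
  rw [← Finset.mul_sum] at h2
  have h3 : (N.card : ℝ) * (ε * (Fintype.card V : ℝ) ^ 2) ≤ ε ^ 2 * (Fintype.card V : ℝ) ^ 3 := by
    linarith
  rcases Nat.eq_zero_or_pos (Fintype.card V) with h0 | h0
  · have : N.card ≤ Fintype.card V := Finset.card_le_univ _
    have hz : N.card = 0 := by omega
    rw [hz, h0]; simp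
  · have h0' : (0 : ℝ) < Fintype.card V := by exact_mod_cast h0
    have : (0 : ℝ) < ε * (Fintype.card V : ℝ) ^ 2 := by positivity
    refine le_of_mul_le_mul_right ?_ this
    linarith [h3]

/-- The neighbourhood of `b` in the link graph of `a`. -/
def nbr (H : ThreeGraph V) (a b : V) : Finset V :=
  univ.filter (fun z => ({b, a, z} : Finset V) ∈ H.edges)

lemma mem_nbr {H : ThreeGraph V} {a b z : V} : z ∈ H.nbr a b ↔ H.Adj a b z := by
  simp only [nbr, Finset.mem_filter, Finset.mem_univ, true_and]
  exact ⟨fun h => Adj.swap_left h, fun h => Adj.swap_left h⟩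

lemma card_link_pairs (H : ThreeGraph V) (a : V) (A B : Finset V) :
    ((A ×ˢ B).filter (fun t => ({t.1, a, t.2} : Finset V) ∈ H.edges)).card =
      ∑ b ∈ A, (H.nbr a b ∩ B).card := by
  rw [← Finset.card_sigma]
  refine Finset.card_bij' (fun t _ => ⟨t.1, t.2⟩) (fun s _ => (s.1, s.2)) ?_ ?_ ?_ ?_
  · rintro ⟨x, y⟩ h
    simp only [Finset.mem_filter, Finset.mem_product] at h
    simp only [nbr, Finset.mem_sigma, Finset.mem_inter, Finset.mem_filter, Finset.mem_univ,
      true_and]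
    tauto
  · rintro ⟨x, y⟩ h
    simp only [nbr, Finset.mem_sigma, Finset.mem_inter, Finset.mem_filter, Finset.mem_univ,
      true_and] at h
    simp only [Finset.mem_filter, Finset.mem_product]
    tauto
  · intros; rfl
  · intros; rfl

lemma LinkDense.sum_nbr {H : ThreeGraph V} {p ε : ℝ} {a : V} (h : H.LinkDense p ε a)
    (A B : Finset V) :
    p * (A.card : ℝ) * (B.card : ℝ) - ε * (Fintype.card V : ℝ) ^ 2 ≤
      ∑ b ∈ A, ((H.nbr a b ∩ B).card : ℝ) := by
  have := h A B
  rw [card_link_pairs] at this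
  exact_mod_cast this

/-- Few vertices have few neighbours in a given set. -/
lemma LinkDense.card_low_mul_le {H : ThreeGraph V} {p ε : ℝ} {a : V} (h : H.LinkDense p ε a)
    (W : Finset V) :
    ((univ.filter (fun b => ((H.nbr a b ∩ W).card : ℝ) < p / 2 * W.card)).card : ℝ) *
      (p / 2 * W.card) ≤ ε * (Fintype.card V : ℝ) ^ 2 := by
  set B := univ.filter (fun b => ((H.nbr a b ∩ W).card : ℝ) < p / 2 * W.card)
  have h1 := h.sum_nbr B W
  have h2 : ∑ b ∈ B, ((H.nbr a b ∩ W).card : ℝ) ≤ ∑ b ∈ B, p / 2 * W.card :=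
    Finset.sum_le_sum fun b hb => (Finset.mem_filter.mp hb).2.le
  rw [Finset.sum_const, nsmul_eq_mul] at h2
  linarith

lemma LinkDense.exists_adj {H : ThreeGraph V} {p ε : ℝ} {a : V} (h : H.LinkDense p ε a)
    (A : Finset V) (hA : ε * (Fintype.card V : ℝ) ^ 2 < p * (A.card : ℝ) * A.card) :
    ∃ z ∈ A, ∃ w ∈ A, H.Adj a z w := by
  by_contra! hc
  have h1 := h.sum_nbr A A
  have h2 : ∑ b ∈ A, ((H.nbr a b ∩ A).card : ℝ) = 0 := by
    refine Finset.sum_eq_zero fun b hb => ?_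
    rw [Nat.cast_eq_zero, Finset.card_eq_zero, Finset.eq_empty_iff_forall_notMem]
    intro z hz
    rw [Finset.mem_inter, mem_nbr] at hz
    exact hc b hb z hz.2 hz.1
  linarith

/-- On average a vertex of `A` has at least `p / 2 * |A|` neighbours in `A` within the link; this
neighbourhood is still linear-sized, so it contains a link edge. -/
lemma LinkDense.exists_triangle {H : ThreeGraph V} {p ε τ : ℝ} {a : V}
    (h : H.LinkDense p ε a) (hp : 0 < p) (hτ : 0 < τ)
    (hn : 0 < Fintype.card V) (A : Finset V) (hA : τ * Fintype.card V ≤ A.card)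
    (h1 : ε ≤ p / 2 * τ ^ 2) (h2 : ε < p * (p / 2 * τ) ^ 2) :
    ∃ b ∈ A, ∃ c ∈ A, ∃ d ∈ A, H.IsK4Minus a b c d := by
  have hn' : (0 : ℝ) < Fintype.card V := by exact_mod_cast hn
  have hA0 : (0 : ℝ) < A.card := lt_of_lt_of_le (by positivity) hA
  have hAne : A.Nonempty := by
    rw [← Finset.card_pos]; exact_mod_cast hA0
  have hA2 : τ ^ 2 * (Fintype.card V : ℝ) ^ 2 ≤ (A.card : ℝ) ^ 2 := by
    rw [← mul_pow]; exact pow_le_pow_left₀ (by positivity) hA 2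
  have hsum : ∑ b ∈ A, (p / 2 * A.card : ℝ) ≤ ∑ b ∈ A, ((H.nbr a b ∩ A).card : ℝ) := by
    refine le_trans ?_ (h.sum_nbr A A)
    rw [Finset.sum_const, nsmul_eq_mul]
    have : ε * (Fintype.card V : ℝ) ^ 2 ≤ p / 2 * (A.card : ℝ) ^ 2 := by
      calc ε * (Fintype.card V : ℝ) ^ 2 ≤ (p / 2 * τ ^ 2) * (Fintype.card V : ℝ) ^ 2 := by gcongr
        _ = p / 2 * (τ ^ 2 * (Fintype.card V : ℝ) ^ 2) := by ring
        _ ≤ _ := by gcongr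
    linarith
  obtain ⟨b, hb, hbA⟩ := Finset.exists_le_of_sum_le hAne hsum
  have hlow : (p / 2 * τ) * Fintype.card V ≤ ((H.nbr a b ∩ A).card : ℝ) := by
    refine le_trans ?_ hbA
    rw [mul_assoc]; gcongr
  obtain ⟨z, hz, w, hw, hzw⟩ := h.exists_adj (H.nbr a b ∩ A) (by
    have : ((p / 2 * τ) * Fintype.card V) ^ 2 ≤ ((H.nbr a b ∩ A).card : ℝ) ^ 2 :=
      pow_le_pow_left₀ (by positivity) hlow 2
    calc ε * (Fintype.card V : ℝ) ^ 2 < (p * (p / 2 * τ) ^ 2) * (Fintype.card V : ℝ) ^ 2 := by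
          gcongr
      _ = p * ((p / 2 * τ) * Fintype.card V) ^ 2 := by ring
      _ ≤ p * ((H.nbr a b ∩ A).card : ℝ) ^ 2 := by gcongr
      _ = _ := by ring)
  rw [Finset.mem_inter, mem_nbr] at hz hw
  exact ⟨b, hb, z, hz.2, w, hw.2, hz.1, hw.1, hzw⟩

open Classical in
/-- Linear-sized sets of vertices contain copies of `K4Minus`. -/
lemma exists_k4Minus_of_subset {H : ThreeGraph V} {p ε τ : ℝ}
    (hbad : ((univ.filter (fun a => ¬ H.LinkDense p ε a)).card : ℝ) ≤ ε * Fintype.card V)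
    (hp : 0 < p) (hτ : 0 < τ) (hn : 0 < Fintype.card V) (A : Finset V)
    (hA : τ * Fintype.card V ≤ A.card)
    (h0 : ε < τ) (h1 : ε ≤ p / 2 * τ ^ 2) (h2 : ε < p * (p / 2 * τ) ^ 2) :
    ∃ a ∈ A, ∃ b ∈ A, ∃ c ∈ A, ∃ d ∈ A, H.IsK4Minus a b c d := by
  have hn' : (0 : ℝ) < Fintype.card V := by exact_mod_cast hn
  obtain ⟨a, haA, ha⟩ : ∃ a ∈ A, H.LinkDense p ε a := by
    by_contra! hc
    have : A ⊆ univ.filter (fun a => ¬ H.LinkDense p ε a) := fun a ha => by simpa using hc a ha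
    have h3 : (A.card : ℝ) ≤ (univ.filter (fun a => ¬ H.LinkDense p ε a)).card := by
      exact_mod_cast Finset.card_le_card this
    nlinarith
  obtain ⟨b, hb, c, hc, d, hd, h⟩ := ha.exists_triangle hp hτ hn A hA h1 h2
  exact ⟨a, haA, b, hb, c, hc, d, hd, h⟩

lemma degree_le_sum_nbr (H : ThreeGraph V) (u : V) :
    H.degree u ≤ ∑ y, (H.nbr u y).card := by
  have h1 := card_link_pairs H u univ univ
  simp only [Finset.inter_univ] at h1
  rw [← h1, degree]
  refine le_trans (Finset.card_le_card (t := ((univ ×ˢ univ).filter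
    (fun t : V × V => ({t.1, u, t.2} : Finset V) ∈ H.edges)).image
      (fun t => ({t.1, u, t.2} : Finset V))) ?_) Finset.card_image_le
  intro e he
  rw [Finset.mem_filter] at he
  obtain ⟨x, y, z, -, -, -, rfl⟩ := Finset.card_eq_three.mp (H.card_edge e he.1)
  simp only [Finset.mem_image, Finset.mem_filter, Finset.mem_product, Finset.mem_univ, true_and,
    Prod.exists]
  have hu := he.2
  simp only [Finset.mem_insert, Finset.mem_singleton] at hu
  have e1 : ({y, x, z} : Finset V) = {x, y, z} := Finset.insert_comm _ _ _
  have e2 : ({x, z, y} : Finset V) = {x, y, z} := by rw [Finset.pair_comm]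
  rcases hu with rfl | rfl | rfl
  · exact ⟨y, z, by rw [e1]; exact he.1, e1⟩
  · exact ⟨x, z, he.1, rfl⟩
  · exact ⟨x, y, by rw [e2]; exact he.1, e2⟩

open Classical in
/-- Every vertex lies in a copy of `K4Minus` whose other vertices avoid a given small set. -/
lemma exists_k4Minus_of_mem {H : ThreeGraph V} {p ε α : ℝ}
    (hbad : ((univ.filter (fun a => ¬ H.LinkDense p ε a)).card : ℝ) ≤ ε * Fintype.card V)
    (hp : 0 < p) (hα : 0 < α) (hn : 0 < Fintype.card V) (u : V)
    (hu : α * (Fintype.card V : ℝ) ^ 2 ≤ (H.degree u : ℝ)) (Z : Finset V)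
    (hZ : (Z.card : ℝ) ≤ α / 4 * Fintype.card V) (h1 : ε < α / 4)
    (h2 : ε < p * (α / 4) ^ 2) :
    ∃ y ∉ Z, ∃ z ∉ Z, ∃ w ∉ Z, H.IsK4Minus y u z w := by
  have hn' : (0 : ℝ) < Fintype.card V := by exact_mod_cast hn
  set n : ℝ := (Fintype.card V : ℝ) with hnd
  -- Averaging: `Z` and the vertices without dense link number less than `α / 2 * n` and contribute
  -- at most `n` each, so they cannot account for the whole degree sum `α n ^ 2` if every other
  -- vertex contributes less than `α / 2 * n`.
  obtain ⟨y, hy1, hy2, hy3⟩ : ∃ y, H.LinkDense p ε y ∧ y ∉ Z ∧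
      α / 2 * n ≤ ((H.nbr u y).card : ℝ) := by
    by_contra! hc
    set X := Z ∪ univ.filter (fun a => ¬ H.LinkDense p ε a) with hX
    have hXc : (X.card : ℝ) < α / 2 * n := by
      have : (X.card : ℝ) ≤ Z.card + (univ.filter (fun a => ¬ H.LinkDense p ε a)).card := by
        exact_mod_cast Finset.card_union_le _ _
      nlinarith
    have hd : (H.degree u : ℝ) ≤ ∑ y, ((H.nbr u y).card : ℝ) := by
      exact_mod_cast degree_le_sum_nbr H u
    have hs : ∑ y, ((H.nbr u y).card : ℝ) ≤
        ∑ y, ((if y ∈ X then n else 0) + α / 2 * n) := by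
      refine Finset.sum_le_sum fun y _ => ?_
      split_ifs with hyX
      · have : ((H.nbr u y).card : ℝ) ≤ n := by rw [hnd]; exact_mod_cast Finset.card_le_univ _
        have : 0 < α / 2 * n := by positivity
        linarith
      · simp only [hX, Finset.mem_union, Finset.mem_filter, Finset.mem_univ, true_and, not_or,
          not_not] at hyX
        have := hc y hyX.2 hyX.1
        linarith
    rw [Finset.sum_add_distrib, Finset.sum_ite_mem, Finset.univ_inter, Finset.sum_const,
      Finset.sum_const, nsmul_eq_mul, nsmul_eq_mul, Finset.card_univ, ← hnd] at hs
    nlinarith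
  have hA : α / 4 * n ≤ ((H.nbr u y \ Z).card : ℝ) := by
    have : (H.nbr u y).card ≤ (H.nbr u y \ Z).card + Z.card := by
      have := Finset.le_card_sdiff Z (H.nbr u y)
      omega
    have : ((H.nbr u y).card : ℝ) ≤ (H.nbr u y \ Z).card + Z.card := by exact_mod_cast this
    linarith
  -- In the link of `y`, the vertex `u` is joined to all of `nbr u y`, so any link edge inside this
  -- set closes a triangle with `u`.
  obtain ⟨z, hz, w, hw, hzw⟩ := hy1.exists_adj (H.nbr u y \ Z) (by
    have : (α / 4 * n) ^ 2 ≤ ((H.nbr u y \ Z).card : ℝ) ^ 2 :=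
      pow_le_pow_left₀ (by positivity) hA 2
    calc ε * n ^ 2 < (p * (α / 4) ^ 2) * n ^ 2 := by gcongr
      _ = p * (α / 4 * n) ^ 2 := by ring
      _ ≤ p * ((H.nbr u y \ Z).card : ℝ) ^ 2 := by gcongr
      _ = _ := by ring)
  rw [Finset.mem_sdiff, mem_nbr] at hz hw
  exact ⟨y, hy2, z, hz.2, w, hw.2, hz.1.swap_left, hw.1.swap_left, hzw⟩

end Counting

/-! ### A derandomised choice and a Hall-type matching -/

section Combinatorics

open Classical in
/-- A greedy choice of `m` elements such that, for every `w`, few chosen elements are bad for `w`: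
the potential `∑ w, K ^ (number of elements bad for w)` at most doubles in each step. -/
lemma exists_finset_sum_pow_card_bad_le {α ι : Type*} [DecidableEq α] (𝒲 : Finset ι) (bad : ι → α → Prop)
    {K M : ℝ} (hK : 1 ≤ K) (hM : 0 < M) (P : Finset α → Prop) (h0 : P ∅) (m : ℕ)
    (hstep : ∀ S, P S → S.card < m → ∃ C : Finset α, M ≤ C.card ∧
      (∀ w ∈ 𝒲, K * ((C.filter (bad w)).card : ℝ) ≤ M) ∧ ∀ t ∈ C, t ∉ S ∧ P (insert t S)) :
    ∃ S, S.card = m ∧ P S ∧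
      ∑ w ∈ 𝒲, K ^ (S.filter (bad w)).card ≤ 𝒲.card * 2 ^ m := by
  suffices H : ∀ k ≤ m, ∃ S, S.card = k ∧ P S ∧
      ∑ w ∈ 𝒲, K ^ (S.filter (bad w)).card ≤ 𝒲.card * 2 ^ k from H m le_rfl
  intro k
  induction k with
  | zero => exact fun _ => ⟨∅, by simp, h0, by simp⟩
  | succ k ih =>
    intro hk
    obtain ⟨S, hS, hP, hΦ⟩ := ih (by omega)
    obtain ⟨C, hC, hCb, hCt⟩ := hstep S hP (by omega)
    have hCne : C.Nonempty := by
      rw [← Finset.card_pos]; exact_mod_cast hM.trans_le hC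
    -- Adding `t` multiplies the term of `w` by at most `1 + K` if `t` is bad for `w`, and by `1`
    -- otherwise. Averaged over `C` the factor is at most `1 + K |bad| / |C| ≤ 2`, so some `t` at
    -- most doubles the potential.
    have key : ∑ t ∈ C, ∑ w ∈ 𝒲, K ^ ((insert t S).filter (bad w)).card ≤
        ∑ t ∈ C, 2 * ∑ w ∈ 𝒲, K ^ (S.filter (bad w)).card := by
      have e1 : ∀ t ∈ C, ∀ w ∈ 𝒲, K ^ ((insert t S).filter (bad w)).card ≤
          K ^ (S.filter (bad w)).card * (1 + K * if bad w t then 1 else 0) := by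
        intro t ht w _
        have hKp : 0 ≤ K ^ (S.filter (bad w)).card := by positivity
        rw [Finset.filter_insert]
        split_ifs with h
        · rw [Finset.card_insert_of_notMem (fun h' => (hCt t ht).1 (Finset.mem_filter.mp h').1),
            pow_succ]
          nlinarith
        · simp
      calc _ ≤ ∑ t ∈ C, ∑ w ∈ 𝒲, K ^ (S.filter (bad w)).card *
            (1 + K * if bad w t then 1 else 0) :=
            Finset.sum_le_sum fun t ht => Finset.sum_le_sum fun w hw => e1 t ht w hw
        _ = ∑ w ∈ 𝒲, K ^ (S.filter (bad w)).card * (C.card + K * (C.filter (bad w)).card) := by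
            rw [Finset.sum_comm]
            refine Finset.sum_congr rfl fun w _ => ?_
            rw [← Finset.mul_sum, Finset.sum_add_distrib, ← Finset.mul_sum,
              Finset.sum_boole]
            simp
        _ ≤ ∑ w ∈ 𝒲, K ^ (S.filter (bad w)).card * (2 * C.card) := by
            refine Finset.sum_le_sum fun w hw => ?_
            have := hCb w hw
            gcongr
            linarith
        _ = _ := by
            rw [Finset.sum_const, nsmul_eq_mul, ← Finset.sum_mul]; ring
    obtain ⟨t, ht, hle⟩ := Finset.exists_le_of_sum_le hCne key
    refine ⟨insert t S, ?_, (hCt t ht).2, hle.trans ?_⟩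
    · rw [Finset.card_insert_of_notMem (hCt t ht).1, hS]
    · rw [pow_succ]; linarith

open Classical in
/-- A perfect matching in a bipartite graph with large minimum degrees and no large empty pair. -/
lemma exists_perfect_matching {α β : Type*} [DecidableEq β] (S : Finset α) (U : Finset β) (N : α → Finset β)
    (s : ℝ) (hne : S.Nonempty) (hcard : S.card = U.card) (h1 : ∀ t ∈ S, s ≤ ((N t ∩ U).card : ℝ))
    (h2 : ∀ u ∈ U, s ≤ ((S.filter (fun t => u ∈ N t)).card : ℝ))
    (h3 : ∀ W ⊆ U, s ≤ W.card → ((S.filter (fun t => N t ∩ W = ∅)).card : ℝ) < s) :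
    ∃ f : α → β, Set.InjOn f S ∧ (∀ t ∈ S, f t ∈ N t) ∧ S.image f = U := by
  have hall : ∀ X ⊆ S, X.card ≤ (X.biUnion (fun t => N t ∩ U)).card := by
    intro X hX
    -- A Hall violator `X` has at least `s` elements, since one of them already has `s` neighbours.
    -- Nothing in `X` sees `U \ Y`, so `h3` forces `|U \ Y| < s`. But a vertex of `U \ Y` has its
    -- `s` neighbours in `S \ X`, which is no larger than `U \ Y`.
    by_contra! hlt
    set Y := X.biUnion (fun t => N t ∩ U) with hY
    have hYU : Y ⊆ U := Finset.biUnion_subset.mpr fun t _ => Finset.inter_subset_right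
    have hWc : (U \ Y).card = U.card - Y.card := Finset.card_sdiff_of_subset hYU
    have hXS := Finset.card_le_card hX
    have hXS' : (S \ X).card = S.card - X.card := Finset.card_sdiff_of_subset hX
    obtain ⟨t, ht⟩ : X.Nonempty := by rw [← Finset.card_pos]; omega
    have hsX : s ≤ X.card := by
      have e1 := h1 t (hX ht)
      have e2 : ((N t ∩ U).card : ℝ) ≤ Y.card := by
        exact_mod_cast Finset.card_le_card
          (Finset.subset_biUnion_of_mem (fun t => N t ∩ U) ht)
      have e3 : (Y.card : ℝ) ≤ X.card := by exact_mod_cast hlt.le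
      linarith
    have hWs : ((U \ Y).card : ℝ) < s := by
      by_contra! hge
      have e1 := h3 (U \ Y) Finset.sdiff_subset hge
      have e2 : (X.card : ℝ) ≤ (S.filter (fun t => N t ∩ (U \ Y) = ∅)).card := by
        refine Nat.cast_le.mpr (Finset.card_le_card fun t' ht' => ?_)
        rw [Finset.mem_filter]
        refine ⟨hX ht', Finset.eq_empty_of_forall_notMem fun v hv => ?_⟩
        rw [Finset.mem_inter, Finset.mem_sdiff] at hv
        exact hv.2.2 (Finset.mem_biUnion.mpr ⟨t', ht', Finset.mem_inter.mpr ⟨hv.1, hv.2.1⟩⟩)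
      linarith
    obtain ⟨u, hu⟩ : (U \ Y).Nonempty := by rw [← Finset.card_pos]; omega
    rw [Finset.mem_sdiff] at hu
    have e1 := h2 u hu.1
    have e2 : (S.filter (fun t => u ∈ N t)).card ≤ (S \ X).card := by
      refine Finset.card_le_card fun t' ht' => ?_
      rw [Finset.mem_filter] at ht'
      rw [Finset.mem_sdiff]
      refine ⟨ht'.1, fun hX' => hu.2 ?_⟩
      exact Finset.mem_biUnion.mpr ⟨t', hX', Finset.mem_inter.mpr ⟨ht'.2, hu.1⟩⟩
    have e3 : ((S.filter (fun t => u ∈ N t)).card : ℝ) ≤ (U \ Y).card := by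
      exact_mod_cast (by omega : (S.filter (fun t => u ∈ N t)).card ≤ (U \ Y).card)
    linarith
  obtain ⟨g, hg, hgm⟩ := (Finset.all_card_le_biUnion_card_iff_exists_injective
    (fun t : S => N t ∩ U)).mp (by
      intro s'
      have := hall (s'.map (Function.Embedding.subtype _)) (by
        intro x hx
        rw [Finset.mem_map] at hx
        obtain ⟨y, -, rfl⟩ := hx
        exact y.2)
      rw [Finset.card_map] at this
      convert this using 2
      ext v
      simp)
  obtain ⟨t0, ht0⟩ := hne
  let f : α → β := fun t => if h : t ∈ S then g ⟨t, h⟩ else g ⟨t0, ht0⟩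
  have hf : ∀ t (h : t ∈ S), f t = g ⟨t, h⟩ := fun t h => dif_pos h
  have hinj : Set.InjOn f S := by
    intro a ha b hb hab
    rw [hf a ha, hf b hb] at hab
    simpa using hg hab
  refine ⟨f, hinj, fun t ht => ?_, ?_⟩
  · rw [hf t ht]; exact (Finset.mem_inter.mp (hgm ⟨t, ht⟩)).1
  · refine Finset.eq_of_subset_of_card_le ?_ ?_
    · intro u hu
      rw [Finset.mem_image] at hu
      obtain ⟨t, ht, rfl⟩ := hu
      rw [hf t ht]; exact (Finset.mem_inter.mp (hgm ⟨t, ht⟩)).2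
    · rw [Finset.card_image_of_injOn hinj, hcard]

end Combinatorics

/-! ### Greedy covering and greedy removal of copies -/

section Greedy

variable {V W : Type*} [DecidableEq V] {F : ThreeGraph W} {H : ThreeGraph V}

lemma exists_tileable_cover {b : ℝ} {r : ℕ}
    (hcov : ∀ (u : V) (Z : Finset V), (Z.card : ℝ) ≤ b → u ∉ Z →
      ∃ C : Finset V, u ∈ C ∧ Disjoint C Z ∧ C.card = r ∧ Tileable F H C)
    (hr : 1 ≤ r) (B : Finset V) :
    ∀ Z : Finset V, Disjoint B Z → (Z.card : ℝ) + r * B.card ≤ b →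
      ∃ C : Finset V, B ⊆ C ∧ Disjoint C Z ∧ (C.card : ℝ) ≤ r * B.card ∧
        r ∣ C.card ∧ Tileable F H C := by
  induction B using Finset.induction_on with
  | empty =>
    intro Z _ _
    exact ⟨∅, by simp, by simp, by simp, by simp, by simpa using tileable_empty F H⟩
  | insert u B hu ih =>
    intro Z hd hZ
    rw [Finset.card_insert_of_notMem hu] at hZ
    push_cast at hZ
    rw [Finset.disjoint_insert_left] at hd
    have hr' : (1 : ℝ) ≤ r := by exact_mod_cast hr
    -- Forbidding `u` keeps it free for its own copy; the one extra forbidden vertex is paid for by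
    -- `r ≥ 1`.
    obtain ⟨C, hBC, hCZ, hCc, hCr, hCt⟩ := ih (insert u Z) (by
      rw [Finset.disjoint_insert_right]; exact ⟨hu, hd.2⟩) (by
      have : ((insert u Z).card : ℝ) ≤ Z.card + 1 := by exact_mod_cast Finset.card_insert_le _ _
      linarith)
    rw [Finset.disjoint_insert_right] at hCZ
    obtain ⟨D, huD, hDZ, hDc, hDt⟩ := hcov u (Z ∪ C) (by
      have : ((Z ∪ C).card : ℝ) ≤ Z.card + C.card := by exact_mod_cast Finset.card_union_le _ _
      linarith) (by simp [hd.1, hCZ.1])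
    rw [Finset.disjoint_union_right] at hDZ
    refine ⟨D ∪ C, ?_, ?_, ?_, ?_, ?_⟩
    · rw [Finset.insert_subset_iff]
      exact ⟨Finset.mem_union_left _ huD, hBC.trans Finset.subset_union_right⟩
    · rw [Finset.disjoint_union_left]; exact ⟨hDZ.1, hCZ.2⟩
    · rw [Finset.card_union_of_disjoint hDZ.2, Finset.card_insert_of_notMem hu, hDc]
      push_cast; linarith
    · rw [Finset.card_union_of_disjoint hDZ.2, hDc]
      exact (dvd_refl r).add hCr
    · rw [Finset.coe_union]
      exact hDt.union hCt (Finset.disjoint_coe.mpr hDZ.2)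

/-- As long as at least `m` vertices are left, those outside `R` number at least `b` and hence
contain a copy to remove. The set `R` survives and the removal stops at exactly `m` vertices. -/
lemma exists_tileable_sdiff {b : ℝ} {r m : ℕ}
    (hcopy : ∀ A : Finset V, b ≤ A.card → ∃ C ⊆ A, C.card = r ∧ Tileable F H C)
    (R : Finset V) (hR : b + R.card ≤ m) (k : ℕ) :
    ∀ X : Finset V, R ⊆ X → X.card = m + r * k →
      ∃ U, R ⊆ U ∧ U ⊆ X ∧ U.card = m ∧ Tileable F H ((X \ U : Finset V) : Set V) := by
  induction k with
  | zero =>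
    intro X hRX hX
    exact ⟨X, hRX, subset_rfl, by simpa using hX, by simpa using tileable_empty F H⟩
  | succ k ih =>
    intro X hRX hX
    obtain ⟨C, hCA, hCc, hCt⟩ := hcopy (X \ R) (by
      have e1 : X.card ≤ (X \ R).card + R.card := by
        have := Finset.le_card_sdiff R X
        omega
      have e2 : (X.card : ℝ) ≤ (X \ R).card + R.card := by exact_mod_cast e1
      have e3 : (m : ℝ) ≤ X.card := by rw [hX]; exact_mod_cast Nat.le_add_right _ _
      linarith)
    have hCX : C ⊆ X := hCA.trans Finset.sdiff_subset
    obtain ⟨U, hRU, hUX, hUc, hUt⟩ := ih (X \ C) (by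
      intro v hv
      rw [Finset.mem_sdiff]
      exact ⟨hRX hv, fun hvC => (Finset.mem_sdiff.mp (hCA hvC)).2 hv⟩) (by
      rw [Finset.card_sdiff_of_subset hCX, hX, hCc, Nat.mul_succ]; omega)
    refine ⟨U, hRU, hUX.trans Finset.sdiff_subset, hUc, ?_⟩
    have e : X \ U = C ∪ (X \ C) \ U := by
      ext v
      have h1 : v ∈ U → v ∈ X ∧ v ∉ C := fun h => Finset.mem_sdiff.mp (hUX h)
      have h2 : v ∈ C → v ∈ X := fun h => hCX h
      simp only [Finset.mem_union, Finset.mem_sdiff]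
      tauto
    rw [e, Finset.coe_union]
    refine hCt.union hUt (Finset.disjoint_coe.mpr ?_)
    exact Finset.disjoint_of_subset_right Finset.sdiff_subset Finset.disjoint_sdiff

end Greedy

/-! ### Absorbing triples -/

section Triples

variable {V : Type*} [DecidableEq V]

/-- The set of entries of a triple. -/
def tripleSet (t : V × V × V) : Finset V := {t.1, t.2.1, t.2.2}

lemma card_tripleSet_le (t : V × V × V) : (tripleSet t).card ≤ 3 := Finset.card_le_three

variable [Fintype V]

/-- The vertices that extend a triple to a copy of `K4Minus` whose apex is its first entry. -/
def ext (H : ThreeGraph V) (t : V × V × V) : Finset V := H.nbr t.1 t.2.1 ∩ H.nbr t.1 t.2.2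

lemma isK4Minus_of_mem_ext {H : ThreeGraph V} {t : V × V × V} (ht : tripleSet t ∈ H.edges)
    {u : V} (hu : u ∈ H.ext t) : H.IsK4Minus t.1 t.2.1 t.2.2 u := by
  rw [ext, Finset.mem_inter, mem_nbr, mem_nbr] at hu
  exact ⟨ht, hu⟩

open Classical in
/-- Almost all triples have many extensions in a given linear-sized set. -/
lemma card_triples_few_ext_le {H : ThreeGraph V} {p ε θ : ℝ}
    (hbad : ((univ.filter (fun a => ¬ H.LinkDense p ε a)).card : ℝ) ≤ ε * Fintype.card V)
    (hε : 0 < ε) (hp : 0 < p) (hθ : 0 < θ) (hn : 0 < Fintype.card V) (W : Finset V)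
    (hW : θ * Fintype.card V ≤ W.card) :
    ((univ.filter (fun t => ((H.ext t ∩ W).card : ℝ) < p ^ 2 / 4 * W.card)).card : ℝ) ≤
      (ε + 2 * ε / (p * θ) + 4 * ε / (p ^ 2 * θ)) * (Fintype.card V : ℝ) ^ 3 := by
  set n : ℝ := (Fintype.card V : ℝ) with hnd
  have hn0 : (0 : ℝ) < n := by rw [hnd]; exact_mod_cast hn
  have hW0 : (0 : ℝ) < W.card := lt_of_lt_of_le (by positivity) hW
  have hcard : ∀ A : Finset V, (A.card : ℝ) ≤ n := fun A => by
    rw [hnd]; exact_mod_cast Finset.card_le_univ A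
  let Bd : V → V → V → Prop := fun a b c =>
    (((H.nbr a b ∩ H.nbr a c) ∩ W).card : ℝ) < p ^ 2 / 4 * W.card
  have hsum : ((univ.filter (fun t => ((H.ext t ∩ W).card : ℝ) < p ^ 2 / 4 * W.card)).card : ℝ) =
      ∑ a, ∑ b, ((univ.filter (fun c => Bd a b c)).card : ℝ) := by
    rw [← Finset.sum_boole, Fintype.sum_prod_type]
    refine Finset.sum_congr rfl fun a _ => ?_
    rw [Fintype.sum_prod_type]
    refine Finset.sum_congr rfl fun b _ => ?_
    rw [Finset.sum_boole]
    rfl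
  set Low : V → Finset V → Finset V := fun a W' =>
    univ.filter (fun b => ((H.nbr a b ∩ W').card : ℝ) < p / 2 * W'.card) with hLow
  -- With a dense apex `a` and `b` of normal degree into `W`, a bad `c` has low degree into the
  -- linear-sized set `nbr a b ∩ W`. Dense apex, normal `b`, normal `c`: the failures of these three
  -- give the three terms of the bound.
  have hpt : ∀ a, H.LinkDense p ε a → ∀ b, ((univ.filter (fun c => Bd a b c)).card : ℝ) ≤
      (if b ∈ Low a W then n else 0) + 4 * ε / (p ^ 2 * θ) * n := by
    intro a ha b
    have hpos : 0 < 4 * ε / (p ^ 2 * θ) * n := by positivity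
    split_ifs with hb
    · linarith [hcard (univ.filter (fun c => Bd a b c))]
    · rw [zero_add]
      simp only [hLow, Finset.mem_filter, Finset.mem_univ, true_and, not_lt] at hb
      have hsub : univ.filter (fun c => Bd a b c) ⊆ Low a (H.nbr a b ∩ W) := by
        intro c hc
        simp only [Bd, hLow, Finset.mem_filter, Finset.mem_univ, true_and] at hc ⊢
        rw [← Finset.inter_assoc, Finset.inter_comm (H.nbr a c)]
        nlinarith
      have h1 := ha.card_low_mul_le (H.nbr a b ∩ W)
      have h2 : ((univ.filter (fun c => Bd a b c)).card : ℝ) ≤ (Low a (H.nbr a b ∩ W)).card := by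
        exact_mod_cast Finset.card_le_card hsub
      have h3 : p ^ 2 / 4 * θ * n ≤ p / 2 * ((H.nbr a b ∩ W).card : ℝ) := by
        have : p ^ 2 / 4 * (θ * n) ≤ p ^ 2 / 4 * W.card := by gcongr
        nlinarith
      have h4 : ((univ.filter (fun c => Bd a b c)).card : ℝ) * (p ^ 2 / 4 * θ * n) ≤
          ε * n ^ 2 := by
        refine le_trans ?_ h1
        gcongr
      have h5 : (4 * ε / (p ^ 2 * θ) * n) * (p ^ 2 / 4 * θ * n) = ε * n ^ 2 := by
        field_simp
      refine le_of_mul_le_mul_right ?_ (show 0 < p ^ 2 / 4 * θ * n by positivity)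
      rw [h5]; exact h4
  have hLowc : ∀ a, H.LinkDense p ε a → ((Low a W).card : ℝ) ≤ 2 * ε / (p * θ) * n := by
    intro a ha
    have h1 := ha.card_low_mul_le W
    have h2 : ((Low a W).card : ℝ) * (p / 2 * θ * n) ≤ ε * n ^ 2 := by
      refine le_trans ?_ h1
      rw [mul_assoc (p / 2)]
      gcongr
    have h3 : (2 * ε / (p * θ) * n) * (p / 2 * θ * n) = ε * n ^ 2 := by
      field_simp
    refine le_of_mul_le_mul_right ?_ (show 0 < p / 2 * θ * n by positivity)
    rw [h3]; exact h2
  have hrow : ∀ a, ∑ b, ((univ.filter (fun c => Bd a b c)).card : ℝ) ≤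
      (if ¬ H.LinkDense p ε a then n ^ 2 else 0) +
        (2 * ε / (p * θ) + 4 * ε / (p ^ 2 * θ)) * n ^ 2 := by
    intro a
    have hpos : 0 < (2 * ε / (p * θ) + 4 * ε / (p ^ 2 * θ)) * n ^ 2 := by positivity
    by_cases ha : H.LinkDense p ε a
    · rw [if_neg (not_not.mpr ha), zero_add]
      refine (Finset.sum_le_sum fun b _ => hpt a ha b).trans ?_
      rw [Finset.sum_add_distrib, Finset.sum_ite_mem, Finset.univ_inter, Finset.sum_const,
        Finset.sum_const, nsmul_eq_mul, nsmul_eq_mul, Finset.card_univ, ← hnd]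
      have := mul_le_mul_of_nonneg_right (hLowc a ha) hn0.le
      linarith
    · rw [if_pos ha]
      have : ∑ b : V, ((univ.filter (fun c => Bd a b c)).card : ℝ) ≤ ∑ b : V, n :=
        Finset.sum_le_sum fun b _ => hcard _
      rw [Finset.sum_const, nsmul_eq_mul, Finset.card_univ, ← hnd] at this
      linarith
  rw [hsum]
  refine (Finset.sum_le_sum fun a _ => hrow a).trans ?_
  rw [Finset.sum_add_distrib, Finset.sum_const, nsmul_eq_mul, Finset.card_univ, ← hnd,
    ← Finset.sum_filter, Finset.sum_const, nsmul_eq_mul]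
  have := mul_le_mul_of_nonneg_right hbad (show 0 ≤ n ^ 2 by positivity)
  linarith

lemma CherryDense.card_edge_triples {H : ThreeGraph V} {p μ : ℝ} (h : H.CherryDense p μ) :
    (p - μ) * (Fintype.card V : ℝ) ^ 3 ≤
      ((univ.filter (fun t : V × V × V => tripleSet t ∈ H.edges)).card : ℝ) := by
  have h1 := h univ univ
  have e : cherries (univ : Finset (V × V)) univ = univ := by simp [cherries]
  rw [e, Finset.card_univ, Fintype.card_prod, Fintype.card_prod] at h1
  push_cast at h1
  have h2 : _ ≤ ((univ.filter (fun t : V × V × V => tripleSet t ∈ H.edges)).card : ℝ) := h1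
  linarith

open Classical in
/-- Many edges avoid a small set and have many extensions in `R`. -/
lemma card_candidate_triples {H : ThreeGraph V} {p μ q ζ c : ℝ} (hH : H.CherryDense p μ)
    (R Z : Finset V)
    (hR : ((univ.filter (fun t => ((H.ext t ∩ R).card : ℝ) < c * R.card)).card : ℝ) ≤
      q * (Fintype.card V : ℝ) ^ 3)
    (hZ : (Z.card : ℝ) ≤ ζ * Fintype.card V) :
    (p - μ - q - 3 * ζ) * (Fintype.card V : ℝ) ^ 3 ≤
      ((univ.filter (fun t => tripleSet t ∈ H.edges ∧ Disjoint (tripleSet t) Z ∧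
        c * R.card ≤ ((H.ext t ∩ R).card : ℝ))).card : ℝ) := by
  set C := univ.filter (fun t => tripleSet t ∈ H.edges ∧ Disjoint (tripleSet t) Z ∧
        c * R.card ≤ ((H.ext t ∩ R).card : ℝ))
  set D := univ.filter (fun t => ((H.ext t ∩ R).card : ℝ) < c * R.card)
  have h1 := hH.card_edge_triples
  -- An edge triple that is not a candidate has few extensions or meets `Z` in one of its three
  -- coordinates, whence the loss `3 * ζ`.
  have hsub : univ.filter (fun t : V × V × V => tripleSet t ∈ H.edges) ⊆
      C ∪ (D ∪ ((Z ×ˢ univ) ∪ ((univ ×ˢ (Z ×ˢ univ)) ∪ (univ ×ˢ (univ ×ˢ Z))))) := by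
    rintro ⟨x, y, z⟩ ht
    replace ht := (Finset.mem_filter.mp ht).2
    simp only [C, D, tripleSet, Finset.mem_filter, Finset.mem_univ, true_and, Finset.mem_union,
      Finset.mem_product, and_true, Finset.disjoint_insert_left,
      Finset.disjoint_singleton_left] at ht ⊢
    rcases lt_or_ge ((H.ext (x, y, z) ∩ R).card : ℝ) (c * R.card) with h | h <;> tauto
  have h2 := (Finset.card_le_card hsub).trans ((Finset.card_union_le _ _).trans
    (Nat.add_le_add_left ((Finset.card_union_le _ _).trans (Nat.add_le_add_left
      ((Finset.card_union_le _ _).trans (Nat.add_le_add_left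
        (Finset.card_union_le _ _) _)) _)) _))
  simp only [Finset.card_product, Finset.card_univ, Fintype.card_prod] at h2
  have h3 : ((univ.filter (fun t : V × V × V => tripleSet t ∈ H.edges)).card : ℝ) ≤
    C.card + (D.card + (Z.card * (Fintype.card V * Fintype.card V) +
      (Fintype.card V * (Z.card * Fintype.card V) +
        Fintype.card V * (Fintype.card V * Z.card)))) := by exact_mod_cast h2
  have h4 := mul_le_mul_of_nonneg_right hZ (show (0 : ℝ) ≤ (Fintype.card V : ℝ) ^ 2 by positivity)
  linarith

open Classical in
/-- A family of disjoint edges whose extension graph has no large sparse pair. -/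
lemma exists_flexible_triples {H : ThreeGraph V} {θ ζ q c M : ℝ} {m N : ℕ} (R : Finset V)
    (hn : 0 < Fintype.card V)
    (hext : ∀ W : Finset V, θ * Fintype.card V ≤ W.card →
      ((univ.filter (fun t => ((H.ext t ∩ W).card : ℝ) < c * W.card)).card : ℝ) ≤
        q * (Fintype.card V : ℝ) ^ 3)
    (hcand : ∀ Z : Finset V, (Z.card : ℝ) ≤ ζ * Fintype.card V → M * (Fintype.card V : ℝ) ^ 3 ≤
      ((univ.filter (fun t => tripleSet t ∈ H.edges ∧ Disjoint (tripleSet t) Z ∧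
        c * R.card ≤ ((H.ext t ∩ R).card : ℝ))).card : ℝ))
    (hM : 0 < M) (hN : 1 ≤ N * θ) (hq : 4 ^ N * q ≤ M) (hm : m < Fintype.card V)
    (hmR : (R.card : ℝ) + 3 * m ≤ ζ * Fintype.card V) :
    ∃ S : Finset (V × V × V), S.card = m ∧
      (∀ t ∈ S, tripleSet t ∈ H.edges ∧ Disjoint (tripleSet t) R ∧
        c * R.card ≤ ((H.ext t ∩ R).card : ℝ)) ∧
      (S : Set (V × V × V)).PairwiseDisjoint tripleSet ∧
      ∀ W : Finset V, θ * Fintype.card V ≤ W.card →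
        ((S.filter (fun t => ((H.ext t ∩ W).card : ℝ) < c * W.card)).card : ℝ) <
          θ * Fintype.card V := by
  have hn0 : (0 : ℝ) < Fintype.card V := by exact_mod_cast hn
  obtain ⟨S, hSm, hP, hΦ⟩ := exists_finset_sum_pow_card_bad_le
    (univ.filter (fun W : Finset V => θ * Fintype.card V ≤ W.card))
    (fun W t => ((H.ext t ∩ W).card : ℝ) < c * W.card) (K := 4 ^ N)
    (M := M * (Fintype.card V : ℝ) ^ 3) (one_le_pow₀ (by norm_num)) (by positivity)
    (fun S => (∀ t ∈ S, tripleSet t ∈ H.edges ∧ Disjoint (tripleSet t) R ∧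
        c * R.card ≤ ((H.ext t ∩ R).card : ℝ)) ∧
      (S : Set (V × V × V)).PairwiseDisjoint tripleSet) (by simp) m (by
    rintro S ⟨hS1, hS2⟩ hSm
    refine ⟨_, hcand (R ∪ S.biUnion tripleSet) ?_, ?_, ?_⟩
    · have e1 : (R ∪ S.biUnion tripleSet).card ≤ R.card + S.card * 3 :=
        (Finset.card_union_le _ _).trans (Nat.add_le_add_left
          (Finset.card_biUnion_le_card_mul _ _ _ fun t _ => card_tripleSet_le t) _)
      have e2 : ((R ∪ S.biUnion tripleSet).card : ℝ) ≤ R.card + m * 3 := by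
        exact_mod_cast e1.trans (by omega)
      linarith
    · intro W hW
      rw [Finset.mem_filter] at hW
      refine le_trans ?_ (mul_le_mul_of_nonneg_right hq
        (show (0 : ℝ) ≤ (Fintype.card V : ℝ) ^ 3 by positivity))
      rw [mul_assoc]
      refine mul_le_mul_of_nonneg_left (le_trans ?_ (hext W hW.2)) (by positivity)
      exact_mod_cast Finset.card_le_card (Finset.filter_subset_filter _ (Finset.subset_univ _))
    · intro t ht
      simp only [Finset.mem_filter, Finset.mem_univ, true_and, Finset.disjoint_union_right,
        Finset.disjoint_biUnion_right] at ht
      obtain ⟨h1, ⟨h2, h3⟩, h4⟩ := ht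
      refine ⟨fun htS => ?_, ?_, ?_⟩
      · have := h3 t htS
        rw [disjoint_self, Finset.bot_eq_empty] at this
        simp [tripleSet] at this
      · intro t' ht'
        rcases Finset.mem_insert.mp ht' with rfl | ht'
        · exact ⟨h1, h2, h4⟩
        · exact hS1 t' ht'
      · rw [Finset.coe_insert]
        exact hS2.insert fun t' ht' _ => h3 t' ht')
  refine ⟨S, hSm, hP.1, hP.2, fun W hW => ?_⟩
  by_contra! hge
  set k := (S.filter (fun t => ((H.ext t ∩ W).card : ℝ) < c * W.card)).card with hk
  have hk1 : Fintype.card V ≤ N * k := by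
    have : (Fintype.card V : ℝ) ≤ N * k := by
      calc (Fintype.card V : ℝ) ≤ (N * θ) * Fintype.card V := le_mul_of_one_le_left hn0.le hN
        _ = N * (θ * Fintype.card V) := by ring
        _ ≤ N * k := by gcongr
    exact_mod_cast this
  -- A single `W` with at least `θ n` bad triples would contribute at least `4 ^ n` to the
  -- potential, because `N * θ ≥ 1`. The potential is at most `2 ^ n * 2 ^ m`, and `m < n`.
  have h1 : ((4 : ℝ) ^ N) ^ k ≤
      (univ.filter (fun W : Finset V => θ * Fintype.card V ≤ W.card)).card * 2 ^ m := by
    refine le_trans ?_ hΦ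
    exact Finset.single_le_sum (f := fun W : Finset V => ((4 : ℝ) ^ N) ^
      (S.filter (fun t => ((H.ext t ∩ W).card : ℝ) < c * W.card)).card)
      (fun _ _ => by positivity) (by simpa using hW)
  have h2 : ((univ.filter (fun W : Finset V => θ * Fintype.card V ≤ W.card)).card : ℝ) ≤
      2 ^ Fintype.card V := by
    have := Finset.card_le_univ (univ.filter (fun W : Finset V => θ * Fintype.card V ≤ W.card))
    rw [Fintype.card_finset] at this
    exact_mod_cast this
  have h3 : (2 : ℝ) ^ m < 2 ^ Fintype.card V := pow_lt_pow_right₀ (by norm_num) hm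
  have h4 : (4 : ℝ) ^ Fintype.card V ≤ (4 ^ N) ^ k := by
    rw [← pow_mul]; exact pow_le_pow_right₀ (by norm_num) hk1
  have h5 : (4 : ℝ) ^ Fintype.card V = 2 ^ Fintype.card V * 2 ^ Fintype.card V := by
    rw [← mul_pow]; norm_num
  have h6 : (0 : ℝ) < 2 ^ Fintype.card V := by positivity
  have h7 : (0 : ℝ) < 2 ^ m := by positivity
  nlinarith

open Classical in
/-- Few vertices extend only few triples of `S`, if every large set is well extended. -/
lemma card_few_triples_lt {H : ThreeGraph V} {s c : ℝ} (S : Finset (V × V × V)) (hc : 0 < c)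
    (hs : 0 < s) (hsS : s ≤ S.card / 2)
    (hS : ∀ W : Finset V, s ≤ W.card →
      ((S.filter (fun t => ((H.ext t ∩ W).card : ℝ) < c * W.card)).card : ℝ) < s) :
    ((univ.filter (fun u => ((S.filter (fun t => u ∈ H.ext t)).card : ℝ) <
      c * S.card / 2)).card : ℝ) < s := by
  by_contra! hge
  set B := univ.filter (fun u => ((S.filter (fun t => u ∈ H.ext t)).card : ℝ) < c * S.card / 2)
  have h1 := hS B hge
  have hB0 : (0 : ℝ) < B.card := hs.trans_le hge
  -- Pairs between `S` and `B` are counted twice: more than half of `S` has at least `c |B|`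
  -- extensions in `B`, whereas each vertex of `B` extends fewer than `c |S| / 2` triples.
  have hdc : ∑ t ∈ S, ((H.ext t ∩ B).card : ℝ) =
      ∑ u ∈ B, ((S.filter (fun t => u ∈ H.ext t)).card : ℝ) := by
    have := Finset.sum_card_bipartiteAbove_eq_sum_card_bipartiteBelow
      (s := S) (t := B) (fun t u => u ∈ H.ext t)
    simp only [Finset.bipartiteAbove, Finset.bipartiteBelow, Finset.filter_mem_eq_inter] at this
    simp only [Finset.inter_comm (H.ext _)]
    exact_mod_cast this
  have hup : ∑ u ∈ B, ((S.filter (fun t => u ∈ H.ext t)).card : ℝ) ≤ B.card * (c * S.card / 2) := by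
    rw [← nsmul_eq_mul]
    exact Finset.sum_le_card_nsmul _ _ _ fun u hu => (Finset.mem_filter.mp hu).2.le
  have hlow : ∑ t ∈ S, (c * B.card - if ((H.ext t ∩ B).card : ℝ) < c * B.card
      then c * B.card else 0) ≤ ∑ t ∈ S, ((H.ext t ∩ B).card : ℝ) := by
    refine Finset.sum_le_sum fun t _ => ?_
    split_ifs with h
    · simp
    · linarith
  rw [Finset.sum_sub_distrib, ← Finset.sum_filter, Finset.sum_const, Finset.sum_const,
    nsmul_eq_mul, nsmul_eq_mul] at hlow
  have hcB : 0 < c * B.card := by positivity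
  nlinarith

end Triples

/-! ### Assembling the factor -/

section Factor

variable {V : Type*} [DecidableEq V] [Fintype V]

/-- Matching a family of disjoint edges with the vertices of `U` gives a tiling. -/
lemma tileable_of_matching {H : ThreeGraph V} (S : Finset (V × V × V)) (U : Finset V)
    (hS : ∀ t ∈ S, tripleSet t ∈ H.edges)
    (hd : (S : Set (V × V × V)).PairwiseDisjoint tripleSet)
    (hU : Disjoint (S.biUnion tripleSet) U) (f : V × V × V → V) (hf : Set.InjOn f S)
    (hfe : ∀ t ∈ S, f t ∈ H.ext t) (hfU : S.image f = U) :
    Tileable K4Minus H ((S.biUnion tripleSet ∪ U : Finset V) : Set V) := by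
  have e : S.biUnion tripleSet ∪ U = S.biUnion (fun t => {t.1, t.2.1, t.2.2, f t}) := by
    ext v
    simp only [← hfU, tripleSet, Finset.mem_union, Finset.mem_biUnion, Finset.mem_image,
      Finset.mem_insert, Finset.mem_singleton]
    constructor
    · rintro (⟨t, ht, h⟩ | ⟨t, ht, rfl⟩)
      · exact ⟨t, ht, by tauto⟩
      · exact ⟨t, ht, by simp⟩
    · rintro ⟨t, ht, h | h | h | h⟩
      · exact Or.inl ⟨t, ht, by tauto⟩
      · exact Or.inl ⟨t, ht, by tauto⟩
      · exact Or.inl ⟨t, ht, by tauto⟩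
      · exact Or.inr ⟨t, ht, h.symm⟩
  rw [e]
  refine Tileable.of_biUnion S _ (fun t ht => (isK4Minus_of_mem_ext (hS t ht)
    (hfe t ht)).tileable) ?_
  have hins : ∀ t : V × V × V, ({t.1, t.2.1, t.2.2, f t} : Finset V) =
      insert (f t) (tripleSet t) := by
    intro t
    ext v
    simp only [tripleSet, Finset.mem_insert, Finset.mem_singleton]
    tauto
  have hnot : ∀ t ∈ S, ∀ t' ∈ S, f t ∉ tripleSet t' := by
    intro t ht t' ht' h
    have hfU' : f t ∈ U := by rw [← hfU]; exact Finset.mem_image_of_mem f ht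
    exact Finset.disjoint_left.mp hU (Finset.mem_biUnion.mpr ⟨t', ht', h⟩) hfU'
  intro t ht t' ht' hne
  simp only [Function.onFun, hins, Finset.disjoint_insert_left, Finset.disjoint_insert_right,
    Finset.mem_insert, not_or]
  exact ⟨⟨fun h => hne (hf ht ht' h.symm), hnot t' ht' t ht⟩, hnot t ht t' ht', hd ht ht' hne⟩

open Classical in
/-- A factor exists once the flexible family of triples can be found and completed. -/
lemma hasFactor_of_flexible {H : ThreeGraph V} {α c γ : ℝ} {m : ℕ} (hc : 0 < c) (hc1 : c ≤ 1 / 4)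
    (hγ : 0 < γ) (hγα : γ ≤ α / 100) (hγ1 : γ ≤ 1 / 100)
    (h4 : 4 ∣ Fintype.card V) (hγn : 100 ≤ γ * Fintype.card V)
    (hm1 : (m : ℝ) ≤ γ * Fintype.card V) (hm2 : γ * Fintype.card V - 1 ≤ m)
    (hcov : ∀ (u : V) (Z : Finset V), (Z.card : ℝ) ≤ α / 4 * Fintype.card V →
      ∃ y ∉ Z, ∃ z ∉ Z, ∃ w ∉ Z, H.IsK4Minus y u z w)
    (hcopy : ∀ A : Finset V, γ / 4 * Fintype.card V ≤ A.card →
      ∃ a ∈ A, ∃ b ∈ A, ∃ c ∈ A, ∃ d ∈ A, H.IsK4Minus a b c d)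
    (R : Finset V) (hR1 : (R.card : ℝ) ≤ m / 2) (hR2 : ((m : ℝ) - 1) / 2 ≤ R.card)
    (S : Finset (V × V × V)) (hSm : S.card = m)
    (hS : ∀ t ∈ S, tripleSet t ∈ H.edges ∧ Disjoint (tripleSet t) R ∧
      c * R.card ≤ ((H.ext t ∩ R).card : ℝ))
    (hSd : (S : Set (V × V × V)).PairwiseDisjoint tripleSet)
    (hSW : ∀ W : Finset V, c * γ / 16 * Fintype.card V ≤ W.card →
      ((S.filter (fun t => ((H.ext t ∩ W).card : ℝ) < c * W.card)).card : ℝ) <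
        c * γ / 16 * Fintype.card V) :
    HasFactor K4Minus H := by
  set n : ℝ := (Fintype.card V : ℝ) with hnd
  have hn0 : 0 < n := by
    by_contra! h
    nlinarith
  have hcg : 0 < c * (γ * n) := by positivity
  have hcg4 : c * (γ * n) ≤ 1 / 4 * (γ * n) := by gcongr
  -- The value `s` serves at once as bound for `|B|` and as degree threshold in the matching: a
  -- triple keeps at least `c |R| - |B|` extensions in `U`, with `|R| ≥ 49 / 100 * γ n`, and a
  -- vertex outside `B` extends at least `c m / 2` triples.
  set s : ℝ := c * γ / 16 * n with hs
  have hs' : s = c * (γ * n) / 16 := by rw [hs]; ring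
  have hs0 : 0 < s := by rw [hs']; positivity
  have hγαn : γ * n ≤ α / 100 * n := by gcongr
  have hγ1n : γ * n ≤ 1 / 100 * n := by gcongr
  set T := S.biUnion tripleSet with hT
  have hTc : T.card = 3 * m := by
    rw [hT, Finset.card_biUnion hSd, Finset.sum_congr rfl fun t ht => H.card_edge _ (hS t ht).1,
      Finset.sum_const, hSm, smul_eq_mul, mul_comm]
  have hTR : Disjoint T R := by
    rw [hT, Finset.disjoint_biUnion_left]
    exact fun t ht => (hS t ht).2.1
  set B := univ.filter (fun u => ((S.filter (fun t => u ∈ H.ext t)).card : ℝ) <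
      c * S.card / 2) with hB
  have hBs : (B.card : ℝ) < s := card_few_triples_lt S hc hs0 (by rw [hSm]; linarith) hSW
  -- Bad vertices inside `T` already belong to chosen edges. The others are covered by copies
  -- avoiding `T` and `R \ B`, which must stay available for the matching.
  obtain ⟨C, hBC, hCZ, hCc, hC4, hCt⟩ := exists_tileable_cover (F := K4Minus) (H := H)
    (b := α / 4 * n) (r := 4) (by
      intro u Z hZ hu
      obtain ⟨y, hy, z, hz, w, hw, h⟩ := hcov u Z hZ
      refine ⟨{y, u, z, w}, by simp, ?_, h.card, h.tileable⟩
      simp only [Finset.disjoint_insert_left, Finset.disjoint_singleton_left]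
      exact ⟨hy, hu, hz, hw⟩) (by norm_num) (B \ T) (T ∪ (R \ B)) (by
      rw [Finset.disjoint_union_right]
      exact ⟨Finset.sdiff_disjoint, Finset.disjoint_of_subset_left Finset.sdiff_subset
        Finset.disjoint_sdiff⟩) (by
      have e1 : ((T ∪ (R \ B)).card : ℝ) ≤ 3 * m + R.card := by
        have := (Finset.card_union_le T (R \ B)).trans
          (Nat.add_le_add_left (Finset.card_le_card Finset.sdiff_subset) _)
        rw [hTc] at this
        exact_mod_cast this
      have e2 : ((B \ T).card : ℝ) ≤ B.card := by
        exact_mod_cast Finset.card_le_card Finset.sdiff_subset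
      push_cast
      linarith)
  have hCc' : (C.card : ℝ) ≤ 4 * s := by
    have e2 : ((B \ T).card : ℝ) ≤ B.card := by
      exact_mod_cast Finset.card_le_card Finset.sdiff_subset
    push_cast at hCc
    linarith
  rw [Finset.disjoint_union_right] at hCZ
  set X := univ \ (T ∪ C) with hX
  -- Here `|X| = n - 3 m - |C|`, and `4` divides both `n` and `|C|`, so `|X| ≡ m` modulo `4`.
  obtain ⟨k, hk⟩ : ∃ k, X.card = m + 4 * k := by
    have e1 : X.card = Fintype.card V - (3 * m + C.card) := by
      rw [hX, Finset.card_sdiff_of_subset (Finset.subset_univ _),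
        Finset.card_union_of_disjoint hCZ.1.symm, hTc, Finset.card_univ]
    have e2 : 4 * m + C.card ≤ Fintype.card V := by
      have : 4 * (m : ℝ) + C.card ≤ Fintype.card V := by rw [← hnd]; linarith
      exact_mod_cast this
    obtain ⟨n', hn'⟩ := h4
    obtain ⟨j, hj⟩ := hC4
    exact ⟨n' - m - j, by omega⟩
  obtain ⟨U, hRU, hUX, hUc, hUt⟩ := exists_tileable_sdiff (F := K4Minus) (H := H)
    (b := γ / 4 * n) (r := 4) (m := m) (by
      intro A hA
      obtain ⟨a, ha, b, hb, c, hc, d, hd, h⟩ := hcopy A hA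
      refine ⟨{a, b, c, d}, ?_, h.card, h.tileable⟩
      simp only [Finset.insert_subset_iff, Finset.singleton_subset_iff]
      exact ⟨ha, hb, hc, hd⟩) (R \ B) (by
      have : ((R \ B).card : ℝ) ≤ R.card := by
        exact_mod_cast Finset.card_le_card Finset.sdiff_subset
      linarith) k X (by
      intro v hv
      simp only [hX, Finset.mem_sdiff, Finset.mem_univ, true_and, Finset.mem_union, not_or]
      exact ⟨fun h => Finset.disjoint_left.mp hTR h (Finset.mem_sdiff.mp hv).1,
        fun h => Finset.disjoint_left.mp hCZ.2 h hv⟩) hk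
  have hUTC : ∀ u ∈ U, u ∉ T ∧ u ∉ C := by
    intro u hu
    have := hUX hu
    simpa [hX] using this
  have hTU : Disjoint T U := Finset.disjoint_right.mpr fun u hu => (hUTC u hu).1
  obtain ⟨f, hf, hfe, hfU⟩ := exists_perfect_matching S U H.ext s (by
      rw [← Finset.card_pos, hSm]
      have : (0 : ℝ) < m := by linarith
      exact_mod_cast this) (hSm.trans hUc.symm) (by
      intro t ht
      have e1 := (hS t ht).2.2
      have e2 : (H.ext t ∩ R).card ≤ (H.ext t ∩ U).card + B.card := by
        refine (Finset.card_le_card ?_).trans (Finset.card_union_le _ _)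
        intro v hv
        rw [Finset.mem_inter] at hv
        rw [Finset.mem_union, Finset.mem_inter]
        by_cases hvB : v ∈ B
        · exact Or.inr hvB
        · exact Or.inl ⟨hv.1, hRU (Finset.mem_sdiff.mpr ⟨hv.2, hvB⟩)⟩
      have e3 : ((H.ext t ∩ R).card : ℝ) ≤ (H.ext t ∩ U).card + B.card := by exact_mod_cast e2
      have e4 : c * (49 / 100 * (γ * n)) ≤ c * R.card := by
        gcongr; linarith
      linarith) (by
      intro u hu
      have huB : u ∉ B := fun h =>
        (hUTC u hu).2 (hBC (Finset.mem_sdiff.mpr ⟨h, (hUTC u hu).1⟩))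
      simp only [hB, Finset.mem_filter, Finset.mem_univ, true_and, not_lt, hSm] at huB
      refine le_trans ?_ huB
      have : c * (99 / 100 * (γ * n)) ≤ c * m := by
        gcongr; linarith
      linarith) (by
      intro W _ hW
      refine lt_of_le_of_lt ?_ (hSW W hW)
      refine Nat.cast_le.mpr (Finset.card_le_card fun t ht => ?_)
      rw [Finset.mem_filter] at ht ⊢
      refine ⟨ht.1, ?_⟩
      rw [ht.2, Finset.card_empty, Nat.cast_zero]
      have : (0 : ℝ) < W.card := hs0.trans_le hW
      positivity)
  have hmain := tileable_of_matching S U (fun t ht => (hS t ht).1) hSd hTU f hf hfe hfU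
  have h1 := hCt.union hUt (by
    rw [Finset.disjoint_coe, Finset.disjoint_right]
    intro v hv
    simp only [hX, Finset.mem_sdiff, Finset.mem_univ, true_and, Finset.mem_union, not_or] at hv
    exact hv.1.2)
  have h2 := hmain.union h1 (by
    rw [← Finset.coe_union, Finset.disjoint_coe, Finset.disjoint_left]
    intro v hv hv'
    simp only [hX, Finset.mem_sdiff, Finset.mem_univ, true_and, Finset.mem_union, not_or]
      at hv hv'
    rcases hv with hv | hv
    · rcases hv' with hv' | hv'
      · exact Finset.disjoint_left.mp hCZ.1 hv' hv
      · exact hv'.1.1 hv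
    · have := hUTC v hv
      tauto)
  have huniv : ((S.biUnion tripleSet ∪ U : Finset V) : Set V) ∪ ((C : Set V) ∪
      ((X \ U : Finset V) : Set V)) = Set.univ := by
    rw [← Finset.coe_union, ← Finset.coe_union, ← Finset.coe_univ, Finset.coe_inj]
    ext v
    simp only [hX, Finset.mem_sdiff, Finset.mem_univ, true_and, Finset.mem_union, not_or, ← hT,
      iff_true]
    tauto
  rw [huniv] at h2
  exact h2

/-- The factor theorem for cherry-dense graphs, with explicit constants. -/
lemma CherryDense.hasFactor_k4Minus {H : ThreeGraph V} {p α c γ θ κ ε : ℝ} {N : ℕ}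
    (hp : 0 < p) (hp1 : p < 1) (hα : 0 < α) (hc : c = p ^ 2 / 4) (hγ0 : 0 < γ)
    (hγα : γ ≤ α / 100) (hγp : γ ≤ p / 100) (hθ : θ = c * γ / 16) (hN : 1 ≤ N * θ)
    (hκ : κ = 1 + 2 / (p * θ) + 4 / (p ^ 2 * θ)) (hε0 : 0 < ε)
    (b1 : ε < γ / 4) (b2 : ε < p / 2 * (γ / 4) ^ 2) (b3 : ε < p * (p / 2 * (γ / 4)) ^ 2)
    (b4 : ε < α / 4) (b5 : ε < p * (α / 4) ^ 2)
    (b6 : ε * (4 ^ N * κ) < p / 2) (b7 : ε * κ < p / 8)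
    (hγn : 100 ≤ γ * Fintype.card V) (h4 : 4 ∣ Fintype.card V) (hH : H.CherryDense p (ε ^ 2))
    (hdeg : ∀ v : V, α * (Fintype.card V : ℝ) ^ 2 ≤ (H.degree v : ℝ)) :
    HasFactor K4Minus H := by
  classical
  have hc0 : 0 < c := by rw [hc]; positivity
  have hc1 : c ≤ 1 / 4 := by rw [hc]; nlinarith
  have hθ0 : 0 < θ := by rw [hθ]; positivity
  have hn0 : 0 < Fintype.card V := by
    rcases Nat.eq_zero_or_pos (Fintype.card V) with h | h
    · rw [h] at hγn; norm_num at hγn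
    · exact h
  have hn0' : (0 : ℝ) < Fintype.card V := by exact_mod_cast hn0
  have hγ1n : γ * Fintype.card V ≤ 1 / 100 * Fintype.card V :=
    mul_le_mul_of_nonneg_right (by linarith) hn0'.le
  have hbad := hH.card_not_linkDense_le hε0
  obtain ⟨m, hm⟩ : ∃ m : ℕ, m = ⌊γ * (Fintype.card V : ℝ)⌋₊ := ⟨_, rfl⟩
  have hm1 : (m : ℝ) ≤ γ * Fintype.card V := by rw [hm]; exact Nat.floor_le (by positivity)
  have hm2 : γ * Fintype.card V - 1 ≤ m := by rw [hm]; exact (Nat.sub_one_lt_floor _).le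
  have hmV : m < Fintype.card V := by
    have : (m : ℝ) < Fintype.card V := by linarith
    exact_mod_cast this
  obtain ⟨R, -, hRc⟩ := Finset.exists_subset_card_eq (s := (univ : Finset V)) (n := m / 2)
    (by rw [Finset.card_univ]; omega)
  have hR1 : (R.card : ℝ) ≤ m / 2 := by rw [hRc]; exact Nat.cast_div_le
  have hR2 : ((m : ℝ) - 1) / 2 ≤ R.card := by
    have : m ≤ 2 * R.card + 1 := by omega
    have : (m : ℝ) ≤ 2 * R.card + 1 := by exact_mod_cast this
    linarith
  have hθR : θ * Fintype.card V ≤ R.card := by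
    have : c * (γ * Fintype.card V) ≤ 1 / 4 * (γ * Fintype.card V) :=
      mul_le_mul_of_nonneg_right hc1 (by positivity)
    have e : θ * Fintype.card V = c * (γ * Fintype.card V) / 16 := by rw [hθ]; ring
    linarith
  have hq : ε + 2 * ε / (p * θ) + 4 * ε / (p ^ 2 * θ) = ε * κ := by rw [hκ]; ring
  have hext := card_triples_few_ext_le hbad hε0 hp hθ0 hn0
  rw [hq, ← hc] at hext
  -- The bound `4 γ n` leaves room for `R` and all chosen triples, as `m / 2 + 3 m ≤ 4 γ n`. The
  -- losses `ε ^ 2`, `ε κ` and `12 γ` are at most `p / 8`, `p / 8` and `12 p / 100`, leaving more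
  -- than `p / 2`.
  have hcand : ∀ Z : Finset V, (Z.card : ℝ) ≤ 4 * γ * Fintype.card V →
      p / 2 * (Fintype.card V : ℝ) ^ 3 ≤
      ((univ.filter (fun t => tripleSet t ∈ H.edges ∧ Disjoint (tripleSet t) Z ∧
        c * R.card ≤ ((H.ext t ∩ R).card : ℝ))).card : ℝ) := by
    intro Z hZ
    refine le_trans ?_ (card_candidate_triples hH R Z (hext R hθR) hZ)
    refine mul_le_mul_of_nonneg_right ?_ (by positivity)
    have : ε ^ 2 ≤ p / 8 := by nlinarith
    linarith
  obtain ⟨S, hSm, hS, hSd, hSW⟩ := exists_flexible_triples (m := m) R hn0 hext hcand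
    (by positivity) hN (by linarith) hmV (by linarith)
  rw [hθ] at hSW
  exact hasFactor_of_flexible hc0 hc1 hγ0 hγα (by linarith) h4 hγn hm1 hm2
    (fun u Z hZ => exists_k4Minus_of_mem hbad hp hα hn0 u (hdeg u) Z hZ b4 b5)
    (fun A hA => exists_k4Minus_of_subset hbad hp (by positivity) hn0 A hA b1 b2.le b3)
    R hR1 hR2 S hSm hS hSd hSW

end Factor

theorem memFactorClass_cherry_k4Minus : MemFactorClass QuasiNotion.cherry K4Minus := by
  intro p α hp hp1 hα hα1
  obtain ⟨c, hc⟩ : ∃ c : ℝ, c = p ^ 2 / 4 := ⟨_, rfl⟩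
  obtain ⟨γ, hγ⟩ : ∃ γ : ℝ, γ = min α p / 100 := ⟨_, rfl⟩
  have hc0 : 0 < c := by rw [hc]; positivity
  have hγ0 : 0 < γ := by rw [hγ]; have := lt_min hα hp; positivity
  have hγα : γ ≤ α / 100 := by rw [hγ]; have := min_le_left α p; linarith
  have hγp : γ ≤ p / 100 := by rw [hγ]; have := min_le_right α p; linarith
  obtain ⟨θ, hθ⟩ : ∃ θ : ℝ, θ = c * γ / 16 := ⟨_, rfl⟩
  have hθ0 : 0 < θ := by rw [hθ]; positivity
  obtain ⟨N, hN⟩ := exists_nat_gt (1 / θ)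
  rw [div_lt_iff₀ hθ0] at hN
  obtain ⟨κ, hκ⟩ : ∃ κ : ℝ, κ = 1 + 2 / (p * θ) + 4 / (p ^ 2 * θ) := ⟨_, rfl⟩
  have hκ0 : 0 < κ := by rw [hκ]; positivity
  -- The first three bounds give copies in sets of size `γ / 4 * n`, the next two give copies
  -- through a prescribed vertex, and the last two serve the potential argument and the supply of
  -- candidate triples.
  obtain ⟨ε, hb, hε0⟩ : ∃ ε, (ε < γ / 4 ∧ ε < p / 2 * (γ / 4) ^ 2 ∧
      ε < p * (p / 2 * (γ / 4)) ^ 2 ∧ ε < α / 4 ∧ ε < p * (α / 4) ^ 2 ∧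
      ε < p / 2 / (4 ^ N * κ) ∧ ε < p / 8 / κ) ∧ 0 < ε := by
    have hev : ∀ b : ℝ, 0 < b → ∀ᶠ ε in nhdsWithin (0 : ℝ) (Set.Ioi 0), ε < b := fun b hb =>
      (eventually_lt_nhds hb).filter_mono nhdsWithin_le_nhds
    refine Filter.Eventually.exists (f := nhdsWithin (0 : ℝ) (Set.Ioi 0))
      (Filter.Eventually.and ?_ self_mem_nhdsWithin)
    exact (hev _ (by positivity)).and <| (hev _ (by positivity)).and <|
      (hev _ (by positivity)).and <| (hev _ (by positivity)).and <|
      (hev _ (by positivity)).and <|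
      (hev _ (by positivity)).and (hev _ (by positivity))
  obtain ⟨b1, b2, b3, b4, b5, b6, b7⟩ := hb
  rw [lt_div_iff₀ (by positivity)] at b6 b7
  obtain ⟨n₀, hn₀⟩ := exists_nat_gt (100 / γ)
  rw [div_lt_iff₀ hγ0] at hn₀
  refine ⟨n₀, ε ^ 2, by positivity, ?_⟩
  intro V _ _ H hn h4 hH hdeg
  rw [Fintype.card_fin] at h4
  have hnn : (n₀ : ℝ) ≤ Fintype.card V := by exact_mod_cast hn
  have hγn : 100 ≤ γ * Fintype.card V := by
    have := mul_le_mul_of_nonneg_left hnn hγ0.le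
    linarith
  exact CherryDense.hasFactor_k4Minus hp hp1 hα hc hγ0 hγα hγp hθ hN.le hκ hε0 b1 b2 b3 b4 b5
    b6 b7 hγn h4 hH hdeg

/-! ### Sign matrices with almost orthogonal rows -/

section SignMatrix

variable {V : Type*} [Fintype V] {M : V → V → ℤ}

lemma sum_boole_zero_le (hzero : ∀ x, (univ.filter (fun y => M x y = 0)).card ≤ 4) (x : V) :
    ∑ y, (if M x y = 0 then (1 : ℝ) else 0) ≤ 4 := by
  rw [Finset.sum_boole]
  exact_mod_cast hzero x

/-- Inner products of rows. -/
def rowInner (M : V → V → ℤ) (x x' : V) : ℝ := ∑ y, (M x y : ℝ) * M x' y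

lemma abs_rowInner_le (hval : ∀ x y, M x y = -1 ∨ M x y = 0 ∨ M x y = 1) (x x' : V) :
    |rowInner M x x'| ≤ Fintype.card V := by
  refine (Finset.abs_sum_le_sum_abs _ _).trans ?_
  rw [← Finset.card_univ, ← nsmul_one]
  refine Finset.sum_le_card_nsmul _ _ _ fun y _ => ?_
  rcases hval x y with h1 | h1 | h1 <;> rcases hval x' y with h2 | h2 | h2 <;> simp [h1, h2]

/-- Expanding the square turns the left side into the sum of all inner products of rows indexed by
`X`. -/
lemma sum_sq_colSum_le (hrow : ∀ x, ∑ x', |rowInner M x x'| ≤ 8 * Fintype.card V)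
    (X : Finset V) :
    ∑ y, (∑ x ∈ X, (M x y : ℝ)) ^ 2 ≤ 8 * (Fintype.card V : ℝ) ^ 2 := by
  have e : ∑ y, (∑ x ∈ X, (M x y : ℝ)) ^ 2 = ∑ x ∈ X, ∑ x' ∈ X, rowInner M x x' := by
    simp only [sq, Finset.sum_mul_sum, rowInner]
    rw [Finset.sum_comm]
    exact Finset.sum_congr rfl fun x _ => Finset.sum_comm
  rw [e]
  calc ∑ x ∈ X, ∑ x' ∈ X, rowInner M x x' ≤ ∑ x ∈ X, (8 * (Fintype.card V : ℝ)) := by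
        refine Finset.sum_le_sum fun x _ => le_trans ?_ (hrow x)
        exact (Finset.sum_le_sum fun x' _ => le_abs_self _).trans
          (Finset.sum_le_sum_of_subset_of_nonneg (Finset.subset_univ _)
            fun _ _ _ => abs_nonneg _)
    _ = X.card * (8 * (Fintype.card V : ℝ)) := by rw [Finset.sum_const, nsmul_eq_mul]
    _ ≤ Fintype.card V * (8 * (Fintype.card V : ℝ)) := by
        gcongr; exact Finset.card_le_univ X
    _ = _ := by ring

/-- Expanding the square, the sums over `y` and over `z` separate, and antisymmetry makes both of
them the inner product of rows `x` and `x'`. One factor is bounded by `n`, the other is summed by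
`hrow`. -/
lemma sum_sq_pathSum_le (hval : ∀ x y, M x y = -1 ∨ M x y = 0 ∨ M x y = 1)
    (hanti : ∀ x y, M y x = -M x y)
    (hrow : ∀ x, ∑ x', |rowInner M x x'| ≤ 8 * Fintype.card V) (X : Finset V) :
    ∑ y, ∑ z, (∑ x ∈ X, (M z x : ℝ) * M x y) ^ 2 ≤ 8 * (Fintype.card V : ℝ) ^ 3 := by
  have e : ∑ y, ∑ z, (∑ x ∈ X, (M z x : ℝ) * M x y) ^ 2 =
      ∑ x ∈ X, ∑ x' ∈ X, rowInner M x x' * rowInner M x x' := by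
    simp only [sq, Finset.sum_mul_sum, rowInner]
    have e1 : ∀ y : V, ∑ z, ∑ x ∈ X, ∑ x' ∈ X, ((M z x : ℝ) * M x y) * (M z x' * M x' y) =
        ∑ x ∈ X, ∑ x' ∈ X, ∑ z, ((M z x : ℝ) * M x y) * (M z x' * M x' y) := by
      intro y
      rw [Finset.sum_comm]
      exact Finset.sum_congr rfl fun x _ => Finset.sum_comm
    simp only [e1]
    rw [Finset.sum_comm]
    refine Finset.sum_congr rfl fun x _ => ?_
    rw [Finset.sum_comm]
    refine Finset.sum_congr rfl fun x' _ => ?_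
    refine Finset.sum_congr rfl fun y _ => Finset.sum_congr rfl fun z _ => ?_
    rw [hanti x z, hanti x' z]
    push_cast
    ring
  rw [e]
  calc ∑ x ∈ X, ∑ x' ∈ X, rowInner M x x' * rowInner M x x'
      ≤ ∑ x ∈ X, ∑ x' : V, Fintype.card V * |rowInner M x x'| := by
        refine Finset.sum_le_sum fun x _ => ?_
        refine le_trans (Finset.sum_le_sum fun x' _ => ?_)
          (Finset.sum_le_sum_of_subset_of_nonneg (Finset.subset_univ _)
            fun _ _ _ => by positivity)
        rw [← abs_mul_abs_self]
        exact mul_le_mul_of_nonneg_right (abs_rowInner_le hval x x') (abs_nonneg _)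
    _ ≤ ∑ x ∈ X, (Fintype.card V * (8 * (Fintype.card V : ℝ))) := by
        refine Finset.sum_le_sum fun x _ => ?_
        rw [← Finset.mul_sum]
        exact mul_le_mul_of_nonneg_left (hrow x) (by positivity)
    _ = X.card * (Fintype.card V * (8 * (Fintype.card V : ℝ))) := by
        rw [Finset.sum_const, nsmul_eq_mul]
    _ ≤ Fintype.card V * (Fintype.card V * (8 * (Fintype.card V : ℝ))) := by
        gcongr; exact Finset.card_le_univ X
    _ = _ := by ring

/-- Cauchy–Schwarz over at most `n ^ 2` pairs bounds the squared sum by `8 n ^ 5`, which is at most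
`(μ / 2 * n ^ 3) ^ 2` once `32 ≤ μ ^ 2 n`. -/
lemma neg_le_sum_of_sum_sq_le {μ : ℝ} (hμ : 0 < μ) (hn : 32 ≤ μ ^ 2 * Fintype.card V)
    (g : V → V → ℝ) (hg : ∑ y, ∑ z, g y z ^ 2 ≤ 8 * (Fintype.card V : ℝ) ^ 3)
    (Y : Finset (V × V)) :
    -(μ / 2 * (Fintype.card V : ℝ) ^ 3) ≤ ∑ t ∈ Y, g t.1 t.2 := by
  refine (abs_le_of_sq_le_sq' ?_ (by positivity)).1
  have hY : (Y.card : ℝ) ≤ (Fintype.card V : ℝ) ^ 2 := by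
    have := Finset.card_le_univ Y
    rw [Fintype.card_prod, ← sq] at this
    exact_mod_cast this
  have h1 : ∑ t ∈ Y, g t.1 t.2 ^ 2 ≤ 8 * (Fintype.card V : ℝ) ^ 3 := by
    refine le_trans ?_ hg
    rw [← Fintype.sum_prod_type' (fun y z => g y z ^ 2)]
    exact Finset.sum_le_sum_of_subset_of_nonneg (Finset.subset_univ _) fun _ _ _ => sq_nonneg _
  calc (∑ t ∈ Y, g t.1 t.2) ^ 2 ≤ Y.card * ∑ t ∈ Y, g t.1 t.2 ^ 2 := sq_sum_le_card_mul_sum_sq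
    _ ≤ (Fintype.card V : ℝ) ^ 2 * (8 * (Fintype.card V : ℝ) ^ 3) := by gcongr
    _ = 32 * ((Fintype.card V : ℝ) ^ 5 / 4) := by ring
    _ ≤ (μ ^ 2 * Fintype.card V) * ((Fintype.card V : ℝ) ^ 5 / 4) := by gcongr
    _ = _ := by ring

end SignMatrix

/-! ### The hypergraph of cyclic triangles -/

section Cyclic

variable {V : Type*} [Fintype V] [DecidableEq V]

/-- The `3`-graph of cyclic triangles of the oriented graph with arcs `x → y` for `M x y = 1`. -/
def cyclicGraph (M : V → V → ℤ) : ThreeGraph V where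
  edges := univ.filter (fun e => e.card = 3 ∧
    ∃ x y z, e = {x, y, z} ∧ M x y = 1 ∧ M y z = 1 ∧ M z x = 1)
  card_edge := fun _ he => (Finset.mem_filter.mp he).2.1

variable {M : V → V → ℤ}

lemma adj_cyclicGraph (hanti : ∀ x y, M y x = -M x y) {x y z : V} :
    (cyclicGraph M).Adj x y z ↔ (M x y = 1 ∧ M y z = 1 ∧ M z x = 1) ∨
      (M x y = -1 ∧ M y z = -1 ∧ M z x = -1) := by
  have hdiag : ∀ x, M x x = 0 := fun x => by have := hanti x x; omega
  constructor
  · intro h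
    have hd := h.distinct
    obtain ⟨-, -, a, b, c, he, h1, h2, h3⟩ := Finset.mem_filter.mp h
    have hx : x ∈ ({a, b, c} : Finset V) := by rw [← he]; simp
    have hy : y ∈ ({a, b, c} : Finset V) := by rw [← he]; simp
    have hz : z ∈ ({a, b, c} : Finset V) := by rw [← he]; simp
    have e1 := hanti a b
    have e2 := hanti b c
    have e3 := hanti c a
    clear h he
    simp only [Finset.mem_insert, Finset.mem_singleton] at hx hy hz
    rcases hx with rfl | rfl | rfl <;> rcases hy with rfl | rfl | rfl <;>
      rcases hz with rfl | rfl | rfl <;>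
        first | exact absurd rfl hd.1 | exact absurd rfl hd.2.1 | exact absurd rfl hd.2.2 | omega
  · intro h
    have hne : ∀ a b : V, M a b ≠ 0 → a ≠ b := by
      rintro a b hab rfl; exact hab (hdiag a)
    have hxy : x ≠ y := hne _ _ (by omega)
    have hyz : y ≠ z := hne _ _ (by omega)
    have hzx : z ≠ x := hne _ _ (by omega)
    refine Finset.mem_filter.mpr ⟨Finset.mem_univ _, ?_, ?_⟩
    · rw [Finset.card_eq_three]
      exact ⟨x, y, z, hxy, hzx.symm, hyz, rfl⟩
    · rcases h with h | h
      · exact ⟨x, y, z, rfl, h⟩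
      · refine ⟨y, x, z, Finset.insert_comm _ _ _, ?_, ?_, ?_⟩
        · rw [hanti x y]; omega
        · rw [hanti z x]; omega
        · rw [hanti y z]; omega

/-- If `a`, `b`, `c` form a cyclic triangle, then `b` and `c` lie on opposite sides of `a`, one an
out-neighbour and one an in-neighbour. Three vertices cannot be pairwise on opposite sides. -/
lemma not_isK4Minus_cyclicGraph (hanti : ∀ x y, M y x = -M x y) (a b c d : V) :
    ¬ (cyclicGraph M).IsK4Minus a b c d := by
  rintro ⟨h1, h2, h3⟩
  rw [adj_cyclicGraph hanti] at h1 h2 h3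
  have e1 := hanti a c
  have e2 := hanti a d
  omega

lemma not_hasFactor_cyclicGraph [Nonempty V] (hanti : ∀ x y, M y x = -M x y) :
    ¬ HasFactor K4Minus (cyclicGraph M) := by
  rintro ⟨T, -, hT⟩
  obtain ⟨v⟩ := ‹Nonempty V›
  have hv : v ∈ ⋃ c ∈ T, c.vertexSet := by rw [hT]; trivial
  simp only [Set.mem_iUnion] at hv
  obtain ⟨c, -, -⟩ := hv
  refine not_isK4Minus_cyclicGraph hanti (c.emb 0) (c.emb 1) (c.emb 2) (c.emb 3) ⟨?_, ?_, ?_⟩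
  · simpa [Adj, Finset.map_insert] using c.map_edge {0, 1, 2} (by simp [K4Minus])
  · simpa [Adj, Finset.map_insert] using c.map_edge {0, 1, 3} (by simp [K4Minus])
  · simpa [Adj, Finset.map_insert] using c.map_edge {0, 2, 3} (by simp [K4Minus])

/-- Pointwise lower bound for the indicator function of cyclic triangles. -/
lemma indicator_cyclicGraph_ge (hval : ∀ x y, M x y = -1 ∨ M x y = 0 ∨ M x y = 1)
    (hanti : ∀ x y, M y x = -M x y) (x y z : V) :
    (1 : ℝ) + M x y * M y z + M y z * M z x + M z x * M x y ≤
      4 * (if ({x, y, z} : Finset V) ∈ (cyclicGraph M).edges then 1 else 0) +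
      4 * ((if M x y = 0 then 1 else 0) + (if M y z = 0 then 1 else 0) +
        (if M z x = 0 then 1 else 0)) := by
  -- For three signs the left side is `4` if they agree and `0` otherwise. If an entry vanishes, the
  -- left side is at most `4` and the correction on the right is at least `4`.
  have h := adj_cyclicGraph hanti (x := x) (y := y) (z := z)
  unfold Adj at h
  simp only [h]
  rcases hval x y with h1 | h1 | h1 <;> rcases hval y z with h2 | h2 | h2 <;>
    rcases hval z x with h3 | h3 | h3 <;> simp [h1, h2, h3] <;> norm_num

/-- Summing the pointwise bound over `X × Y` gives the main term `|X| |Y|`. Each of the three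
product sums loses at most `μ / 2 * n ^ 3`, and the zero entries lose at most `4 * 12 n ^ 2 ≤ 2 μ n
^ 3`; all this fits into `4 μ n ^ 3`. -/
lemma edgeDense_cyclicGraph (hval : ∀ x y, M x y = -1 ∨ M x y = 0 ∨ M x y = 1)
    (hanti : ∀ x y, M y x = -M x y)
    (hzero : ∀ x, (univ.filter (fun y => M x y = 0)).card ≤ 4)
    (hrow : ∀ x, ∑ x', |rowInner M x x'| ≤ 8 * Fintype.card V) {μ : ℝ} (hμ : 0 < μ)
    (hn : 32 ≤ μ ^ 2 * Fintype.card V) (hn' : 24 ≤ μ * Fintype.card V) :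
    (cyclicGraph M).EdgeDense (1 / 4) μ := by
  intro X Y
  have hsq : ∀ x y, (M x y : ℝ) ^ 2 ≤ 1 := by
    intro x y
    rcases hval x y with h | h | h <;> simp [h]
  have hE1 := neg_le_sum_of_sum_sq_le hμ hn (fun y z => ∑ x ∈ X, (M x y : ℝ) * M y z) (by
    calc ∑ y, ∑ z, (∑ x ∈ X, (M x y : ℝ) * M y z) ^ 2
        ≤ ∑ y, ∑ z : V, (∑ x ∈ X, (M x y : ℝ)) ^ 2 := by
          refine Finset.sum_le_sum fun y _ => Finset.sum_le_sum fun z _ => ?_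
          rw [← Finset.sum_mul, mul_pow]
          exact mul_le_of_le_one_right (sq_nonneg _) (hsq y z)
      _ = Fintype.card V * ∑ y, (∑ x ∈ X, (M x y : ℝ)) ^ 2 := by
          simp [Finset.mul_sum]
      _ ≤ Fintype.card V * (8 * (Fintype.card V : ℝ) ^ 2) := by
          gcongr; exact sum_sq_colSum_le hrow X
      _ = _ := by ring) Y
  have hE2 := neg_le_sum_of_sum_sq_le hμ hn (fun y z => ∑ x ∈ X, (M y z : ℝ) * M z x) (by
    calc ∑ y, ∑ z, (∑ x ∈ X, (M y z : ℝ) * M z x) ^ 2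
        ≤ ∑ y : V, ∑ z, (∑ x ∈ X, (M x z : ℝ)) ^ 2 := by
          refine Finset.sum_le_sum fun y _ => Finset.sum_le_sum fun z _ => ?_
          have : ∑ x ∈ X, (M z x : ℝ) = -∑ x ∈ X, (M x z : ℝ) := by
            rw [← Finset.sum_neg_distrib]
            exact Finset.sum_congr rfl fun x _ => by rw [hanti x z]; push_cast; ring
          rw [← Finset.mul_sum, mul_pow, this, neg_sq]
          exact mul_le_of_le_one_left (sq_nonneg _) (hsq y z)
      _ = Fintype.card V * ∑ z, (∑ x ∈ X, (M x z : ℝ)) ^ 2 := by simp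
      _ ≤ Fintype.card V * (8 * (Fintype.card V : ℝ) ^ 2) := by
          gcongr; exact sum_sq_colSum_le hrow X
      _ = _ := by ring) Y
  have hE3 := neg_le_sum_of_sum_sq_le hμ hn (fun y z => ∑ x ∈ X, (M z x : ℝ) * M x y)
    (sum_sq_pathSum_le hval hanti hrow X) Y
  have hZ := sum_boole_zero_le hzero
  have hz' : ∀ x, ∑ z, (if M z x = 0 then (1 : ℝ) else 0) ≤ 4 := by
    intro x
    refine le_trans (le_of_eq (Finset.sum_congr rfl fun z _ => ?_)) (hZ x)
    rw [hanti x z]; simp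
  have hnonneg : ∀ a : ℤ, (0 : ℝ) ≤ if a = 0 then 1 else 0 := by
    intro a; split_ifs <;> norm_num
  have hzall : ∑ t ∈ Y, ∑ x ∈ X, ((if M x t.1 = 0 then (1 : ℝ) else 0) +
      (if M t.1 t.2 = 0 then 1 else 0) + (if M t.2 x = 0 then 1 else 0)) ≤
      12 * (Fintype.card V : ℝ) ^ 2 := by
    calc _ ≤ ∑ t : V × V, ∑ x : V, ((if M x t.1 = 0 then (1 : ℝ) else 0) +
          (if M t.1 t.2 = 0 then 1 else 0) + (if M t.2 x = 0 then 1 else 0)) := by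
          have hnn : ∀ (t : V × V) (x : V), (0 : ℝ) ≤ (if M x t.1 = 0 then (1 : ℝ) else 0) +
              (if M t.1 t.2 = 0 then 1 else 0) + (if M t.2 x = 0 then 1 else 0) :=
            fun t x => add_nonneg (add_nonneg (hnonneg _) (hnonneg _)) (hnonneg _)
          refine le_trans (Finset.sum_le_sum fun t _ =>
            Finset.sum_le_sum_of_subset_of_nonneg (Finset.subset_univ X) fun x _ _ => hnn t x) ?_
          exact Finset.sum_le_sum_of_subset_of_nonneg (Finset.subset_univ Y) fun t _ _ =>
            Finset.sum_nonneg fun x _ => hnn t x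
      _ = ∑ y, ∑ z : V, ∑ x, (if M x y = 0 then (1 : ℝ) else 0) +
          ∑ y, ∑ z, ∑ x : V, (if M y z = 0 then (1 : ℝ) else 0) +
          ∑ y : V, ∑ z, ∑ x, (if M z x = 0 then (1 : ℝ) else 0) := by
          rw [Fintype.sum_prod_type]
          simp only [Finset.sum_add_distrib]
      _ ≤ ∑ y : V, ∑ z : V, 4 + ∑ y : V, (Fintype.card V * 4 : ℝ) +
          ∑ y : V, ∑ z : V, 4 := by
          gcongr with y _ z _ y _ y _ z _
          · exact hz' y
          · simp only [Finset.sum_const, nsmul_eq_mul, Finset.card_univ, ← Finset.mul_sum]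
            gcongr
            exact hZ y
          · exact hZ z
      _ = _ := by
          simp only [Finset.sum_const, nsmul_eq_mul, Finset.card_univ]
          ring
  have hcount : (((X ×ˢ Y).filter (fun t => ({t.1, t.2.1, t.2.2} : Finset V) ∈
      (cyclicGraph M).edges)).card : ℝ) = ∑ t ∈ Y, ∑ x ∈ X,
        (if ({x, t.1, t.2} : Finset V) ∈ (cyclicGraph M).edges then 1 else 0) := by
    rw [← Finset.sum_boole, Finset.sum_product_right]
  have hmain : ∑ t ∈ Y, ∑ x ∈ X, ((1 : ℝ) + M x t.1 * M t.1 t.2 + M t.1 t.2 * M t.2 x +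
      M t.2 x * M x t.1) ≤ _ :=
    Finset.sum_le_sum fun t _ => Finset.sum_le_sum fun x _ =>
      indicator_cyclicGraph_ge hval hanti x t.1 t.2
  have hl : ∑ t ∈ Y, ∑ x ∈ X, ((1 : ℝ) + M x t.1 * M t.1 t.2 + M t.1 t.2 * M t.2 x +
      M t.2 x * M x t.1) = X.card * Y.card + ∑ t ∈ Y, ∑ x ∈ X, (M x t.1 : ℝ) * M t.1 t.2 +
      ∑ t ∈ Y, ∑ x ∈ X, (M t.1 t.2 : ℝ) * M t.2 x +
      ∑ t ∈ Y, ∑ x ∈ X, (M t.2 x : ℝ) * M x t.1 := by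
    simp only [Finset.sum_add_distrib, Finset.sum_const, nsmul_eq_mul, mul_one]
    ring
  have hr : ∀ a b : V × V → V → ℝ, ∑ t ∈ Y, ∑ x ∈ X, (4 * a t x + 4 * b t x) =
      4 * ∑ t ∈ Y, ∑ x ∈ X, a t x + 4 * ∑ t ∈ Y, ∑ x ∈ X, b t x := by
    intro a b
    simp only [Finset.sum_add_distrib, Finset.mul_sum]
  rw [hl, hr, ← hcount] at hmain
  have h12 : 12 * (Fintype.card V : ℝ) ^ 2 ≤ μ / 2 * (Fintype.card V : ℝ) ^ 3 := by
    have := mul_le_mul_of_nonneg_right hn' (show (0 : ℝ) ≤ (Fintype.card V : ℝ) ^ 2 / 2 by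
      positivity)
    linarith
  have hpos : 0 ≤ μ * (Fintype.card V : ℝ) ^ 3 := by positivity
  linarith

/-- Since rows and columns sum to zero, all three product terms vanish when summed over `y` and `z`.
Only the zero entries cost anything, at most `4 * 12 n`. -/
lemma degree_cyclicGraph_ge (hval : ∀ x y, M x y = -1 ∨ M x y = 0 ∨ M x y = 1)
    (hanti : ∀ x y, M y x = -M x y)
    (hzero : ∀ x, (univ.filter (fun y => M x y = 0)).card ≤ 4)
    (hsum : ∀ x, ∑ y, M x y = 0) (x : V) :
    (Fintype.card V : ℝ) ^ 2 - 48 * Fintype.card V ≤ 36 * ((cyclicGraph M).degree x : ℝ) := by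
  set P := (univ : Finset (V × V)).filter
    (fun t => ({x, t.1, t.2} : Finset V) ∈ (cyclicGraph M).edges) with hP
  -- A pair that completes `x` to the edge `e` has both entries in `e`, so the crude count of `9`
  -- pairs per edge suffices.
  have hdeg : P.card ≤ 9 * (cyclicGraph M).degree x := by
    have himg : P.image (fun t => ({x, t.1, t.2} : Finset V)) ⊆
        (cyclicGraph M).edges.filter (fun e => x ∈ e) := by
      intro e he
      rw [Finset.mem_image] at he
      obtain ⟨t, ht, rfl⟩ := he
      exact Finset.mem_filter.mpr ⟨(Finset.mem_filter.mp ht).2, by simp⟩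
    refine (Finset.card_le_mul_card_image P 9 fun e he => ?_).trans
      (Nat.mul_le_mul_left _ (Finset.card_le_card himg))
    have hec : e.card = 3 := (cyclicGraph M).card_edge e (Finset.mem_filter.mp (himg he)).1
    calc (P.filter (fun t => ({x, t.1, t.2} : Finset V) = e)).card ≤ (e ×ˢ e).card := by
          refine Finset.card_le_card fun t ht => ?_
          rw [Finset.mem_filter] at ht
          rw [← ht.2]
          simp
      _ = 9 := by rw [Finset.card_product, hec]
  have hdeg' : (P.card : ℝ) ≤ 9 * (cyclicGraph M).degree x := by exact_mod_cast hdeg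
  have hsumR : ∀ x, ∑ y, (M x y : ℝ) = 0 := fun x => by exact_mod_cast hsum x
  have hsumR' : ∀ x, ∑ y, (M y x : ℝ) = 0 := fun x => by
    have : ∑ y, (M y x : ℝ) = -∑ y, (M x y : ℝ) := by
      rw [← Finset.sum_neg_distrib]
      exact Finset.sum_congr rfl fun y _ => by rw [hanti x y]; push_cast; ring
    rw [this, hsumR, neg_zero]
  have hZ := sum_boole_zero_le hzero
  have hZ' : ∑ z, (if M z x = 0 then (1 : ℝ) else 0) ≤ 4 := by
    refine le_trans (le_of_eq (Finset.sum_congr rfl fun z _ => ?_)) (hZ x)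
    rw [hanti x z]; simp
  have hcount : (P.card : ℝ) = ∑ y, ∑ z,
      (if ({x, y, z} : Finset V) ∈ (cyclicGraph M).edges then 1 else 0) := by
    rw [hP, ← Finset.sum_boole, Fintype.sum_prod_type]
  have hmain : ∑ y, ∑ z, ((1 : ℝ) + M x y * M y z + M y z * M z x + M z x * M x y) ≤ _ :=
    Finset.sum_le_sum fun y _ => Finset.sum_le_sum fun z _ =>
      indicator_cyclicGraph_ge hval hanti x y z
  have hl : ∑ y, ∑ z, ((1 : ℝ) + M x y * M y z + M y z * M z x + M z x * M x y) =
      (Fintype.card V : ℝ) ^ 2 := by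
    have e1 : ∑ y, ∑ z, (M x y : ℝ) * M y z = 0 :=
      Finset.sum_eq_zero fun y _ => by rw [← Finset.mul_sum, hsumR, mul_zero]
    have e2 : ∑ y, ∑ z, (M y z : ℝ) * M z x = 0 := by
      rw [Finset.sum_comm]
      exact Finset.sum_eq_zero fun y _ => by rw [← Finset.sum_mul, hsumR', zero_mul]
    have e3 : ∑ y, ∑ z, (M z x : ℝ) * M x y = 0 :=
      Finset.sum_eq_zero fun y _ => by rw [← Finset.sum_mul, hsumR', zero_mul]
    simp only [Finset.sum_add_distrib, e1, e2, e3, Finset.sum_const, nsmul_eq_mul, mul_one,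
      Finset.card_univ]
    ring
  have hr : ∑ y, ∑ z, (4 * (if ({x, y, z} : Finset V) ∈ (cyclicGraph M).edges then (1 : ℝ)
      else 0) + 4 * ((if M x y = 0 then 1 else 0) + (if M y z = 0 then 1 else 0) +
        (if M z x = 0 then 1 else 0))) = 4 * P.card +
      4 * (Fintype.card V * ∑ y, (if M x y = 0 then (1 : ℝ) else 0) +
        ∑ y, ∑ z, (if M y z = 0 then (1 : ℝ) else 0) +
        Fintype.card V * ∑ z, (if M z x = 0 then (1 : ℝ) else 0)) := by
    rw [hcount]
    simp only [Finset.sum_add_distrib, ← Finset.mul_sum, Finset.sum_const, nsmul_eq_mul,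
      Finset.card_univ]
  rw [hl, hr] at hmain
  have h2 : ∑ y, ∑ z, (if M y z = 0 then (1 : ℝ) else 0) ≤ Fintype.card V * 4 := by
    refine (Finset.sum_le_sum fun y _ => hZ y).trans ?_
    rw [Finset.sum_const, nsmul_eq_mul, Finset.card_univ]
  have h1 := mul_le_mul_of_nonneg_left (hZ x) (show (0 : ℝ) ≤ Fintype.card V by positivity)
  have h3 := mul_le_mul_of_nonneg_left hZ' (show (0 : ℝ) ≤ Fintype.card V by positivity)
  linarith

end Cyclic

/-! ### The blown-up Paley tournament -/

section Paley

variable (q : ℕ) [Fact q.Prime]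

/-- The fourfold blow-up of the Paley tournament, as an antisymmetric sign matrix. -/
def paleyBlowup (x y : ZMod q × Fin 4) : ℤ := quadraticChar (ZMod q) (y.1 - x.1)

lemma paleyBlowup_val (x y : ZMod q × Fin 4) :
    paleyBlowup q x y = -1 ∨ paleyBlowup q x y = 0 ∨ paleyBlowup q x y = 1 := by
  unfold paleyBlowup
  by_cases h : y.1 - x.1 = 0
  · simp [h]
  · rcases quadraticChar_dichotomy h with h | h <;> simp [h]

variable {q}

lemma ringChar_zmod_ne_two (hq : q % 4 = 3) : ringChar (ZMod q) ≠ 2 := by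
  rw [ZMod.ringChar_zmod_n]; omega

lemma quadraticChar_zmod_neg_one (hq : q % 4 = 3) : quadraticChar (ZMod q) (-1) = -1 := by
  rw [quadraticChar_neg_one (ringChar_zmod_ne_two hq), ZMod.card]
  exact ZMod.χ₄_nat_three_mod_four hq

lemma paleyBlowup_anti (hq : q % 4 = 3) (x y : ZMod q × Fin 4) :
    paleyBlowup q y x = -paleyBlowup q x y := by
  unfold paleyBlowup
  rw [← neg_sub, ← neg_one_mul, map_mul, quadraticChar_zmod_neg_one hq, neg_one_mul]

lemma card_paleyBlowup_eq_zero (x : ZMod q × Fin 4) :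
    (univ.filter (fun y => paleyBlowup q x y = 0)).card ≤ 4 := by
  have : univ.filter (fun y => paleyBlowup q x y = 0) ⊆ {x.1} ×ˢ (univ : Finset (Fin 4)) := by
    intro y hy
    rw [Finset.mem_filter, paleyBlowup, quadraticChar_eq_zero_iff, sub_eq_zero] at hy
    exact Finset.mem_product.mpr ⟨Finset.mem_singleton.mpr hy.2, Finset.mem_univ _⟩
  simpa using Finset.card_le_card this

lemma sum_paleyBlowup (hq : q % 4 = 3) (x : ZMod q × Fin 4) : ∑ y, paleyBlowup q x y = 0 := by
  unfold paleyBlowup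
  rw [Fintype.sum_prod_type]
  simp only [Finset.sum_const, ← Finset.smul_sum]
  rw [Fintype.sum_equiv (Equiv.subRight x.1) (fun y => quadraticChar (ZMod q) (y - x.1))
    (fun y => quadraticChar (ZMod q) y) (fun _ => rfl),
    quadraticChar_sum_zero (ringChar_zmod_ne_two hq), smul_zero]

/-- The sum equals `-J(χ, χ)`, and `J(χ, χ) = J(χ, χ⁻¹) = -χ(-1) = 1` because `χ` is quadratic and
`q ≡ 3 mod 4`. -/
lemma abs_sum_quadraticChar_mul_le (hq : q % 4 = 3) {a b : ZMod q} (hab : a ≠ b) :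
    |∑ y, quadraticChar (ZMod q) (y - a) * quadraticChar (ZMod q) (y - b)| ≤ 1 := by
  set χ := quadraticChar (ZMod q) with hχ
  have hd : b - a ≠ 0 := sub_ne_zero.mpr hab.symm
  have hne : χ ≠ 1 := quadraticChar_ne_one (ringChar_zmod_ne_two hq)
  have hJ : jacobiSum χ χ = 1 := by
    have := jacobiSum_nontrivial_inv hne
    rw [(quadraticChar_isQuadratic (ZMod q)).inv, ← hχ, quadraticChar_zmod_neg_one hq] at this
    simpa using this
  have key : ∑ y, χ (y - a) * χ (y - b) = -jacobiSum χ χ := by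
    rw [jacobiSum, ← Finset.sum_neg_distrib]
    -- With `y = (b - a) w + a` one has `y - a = (b - a) w` and `y - b = -(b - a) (1 - w)`; the
    -- factor `χ (b - a) ^ 2` is `1`, and `χ (-1) = -1` gives the sign.
    refine (Fintype.sum_equiv ((Equiv.mulLeft₀ (b - a) hd).trans (Equiv.addRight a)) _ _
      fun w => ?_).symm
    have e1 : ((Equiv.mulLeft₀ (b - a) hd).trans (Equiv.addRight a)) w - a = (b - a) * w := by
      simp
    have e2 : ((Equiv.mulLeft₀ (b - a) hd).trans (Equiv.addRight a)) w - b =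
        (-1) * ((b - a) * (1 - w)) := by
      simp; ring
    rw [e1, e2, map_mul, map_mul, map_mul, hχ, quadraticChar_zmod_neg_one hq, ← hχ]
    have := quadraticChar_sq_one hd
    rw [← hχ] at this
    linear_combination (- χ w * χ (1 - w)) * (-this)
  rw [key, hJ]
  norm_num

/-- The four copies of the same tournament vertex contribute at most `n = 4 q` each, and every row
at most `4` besides, so the total is at most `4 n + 4 n`. -/
lemma sum_abs_rowInner_paleyBlowup_le (hq : q % 4 = 3) (x : ZMod q × Fin 4) :
    ∑ x', |rowInner (paleyBlowup q) x x'| ≤ 8 * Fintype.card (ZMod q × Fin 4) := by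
  have hcard : (Fintype.card (ZMod q × Fin 4) : ℝ) = 4 * q := by
    rw [Fintype.card_prod, ZMod.card, Fintype.card_fin]; push_cast; ring
  have hpt : ∀ x', |rowInner (paleyBlowup q) x x'| ≤
      (if x'.1 = x.1 then 4 * (q : ℝ) else 0) + 4 := by
    intro x'
    split_ifs with h
    · have := abs_rowInner_le (paleyBlowup_val q) x x'
      rw [hcard] at this
      linarith
    · have e : rowInner (paleyBlowup q) x x' = 4 *
          ((∑ y, quadraticChar (ZMod q) (y - x.1) * quadraticChar (ZMod q) (y - x'.1) : ℤ) : ℝ) := by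
        unfold rowInner paleyBlowup
        rw [Fintype.sum_prod_type]
        simp only [Finset.sum_const, Finset.card_univ, Fintype.card_fin, nsmul_eq_mul,
          ← Finset.mul_sum]
        push_cast
        rfl
      have h1 := abs_sum_quadraticChar_mul_le hq (Ne.symm h)
      rw [e, abs_mul, ← Int.cast_abs, zero_add]
      have h2 : ((|∑ y, quadraticChar (ZMod q) (y - x.1) *
          quadraticChar (ZMod q) (y - x'.1)| : ℤ) : ℝ) ≤ 1 := by exact_mod_cast h1
      rw [abs_of_pos (by norm_num : (0 : ℝ) < 4)]
      linarith
  refine (Finset.sum_le_sum fun x' _ => hpt x').trans ?_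
  have hdiag : ∑ x' : ZMod q × Fin 4, (if x'.1 = x.1 then 4 * (q : ℝ) else 0) = 4 * (4 * q) := by
    have e : ∑ x' : ZMod q × Fin 4, (if x'.1 = x.1 then 4 * (q : ℝ) else 0) =
        ∑ y : ZMod q, ∑ _j : Fin 4, (if y = x.1 then 4 * (q : ℝ) else 0) :=
      Fintype.sum_prod_type _
    rw [e, Finset.sum_comm]
    simp
  rw [Finset.sum_add_distrib, hdiag, Finset.sum_const, Finset.card_univ, nsmul_eq_mul, hcard]
  linarith

end Paley

/-! ### The counterexample for edge density -/

theorem not_memFactorClass_edge_k4Minus : ¬ MemFactorClass QuasiNotion.edge K4Minus := by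
  intro h
  obtain ⟨n₀, μ, hμ, hF⟩ := h (1 / 4) (1 / 100) (by norm_num) (by norm_num) (by norm_num)
    (by norm_num)
  -- The value `75` serves the degree: `n ≥ 75` gives `n ^ 2 - 48 n ≥ 36 / 100 * n ^ 2`, which is `α
  -- = 1 / 100` after division by `36`.
  obtain ⟨k, hk⟩ := exists_nat_gt (max (n₀ : ℝ) (max (32 / μ ^ 2) (max (24 / μ) 75)))
  obtain ⟨q, hkq, hqp, hq⟩ := Nat.forall_exists_prime_gt_and_eq_mod
    (q := 4) (a := 3) (by decide) k
  have : Fact q.Prime := ⟨hqp⟩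
  have hq4 : q % 4 = 3 := by
    have := (ZMod.natCast_eq_natCast_iff' q 3 4).mp (by exact_mod_cast hq)
    simpa using this
  have hcardN : Fintype.card (ZMod q × Fin 4) = q * 4 := by
    rw [Fintype.card_prod, ZMod.card, Fintype.card_fin]
  have hkn : (k : ℝ) ≤ Fintype.card (ZMod q × Fin 4) := by
    rw [hcardN]; exact_mod_cast (by omega : k ≤ q * 4)
  simp only [max_lt_iff] at hk
  obtain ⟨hk1, hk2, hk3, hk4⟩ := hk
  rw [div_lt_iff₀ (by positivity)] at hk2 hk3
  refine not_hasFactor_cyclicGraph (paleyBlowup_anti hq4)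
    (hF (ZMod q × Fin 4) (cyclicGraph (paleyBlowup q)) ?_ ?_ ?_ ?_)
  · exact_mod_cast hk1.le.trans hkn
  · rw [hcardN, Fintype.card_fin]; exact Dvd.intro_left q rfl
  · refine edgeDense_cyclicGraph (paleyBlowup_val q) (paleyBlowup_anti hq4)
      card_paleyBlowup_eq_zero (sum_abs_rowInner_paleyBlowup_le hq4) hμ ?_ ?_
    · have := mul_le_mul_of_nonneg_left hkn (sq_nonneg μ)
      linarith
    · have := mul_le_mul_of_nonneg_left hkn hμ.le
      linarith
  · intro v
    have h1 := degree_cyclicGraph_ge (paleyBlowup_val q) (paleyBlowup_anti hq4)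
      card_paleyBlowup_eq_zero (sum_paleyBlowup hq4) v
    have h2 : (75 : ℝ) ≤ Fintype.card (ZMod q × Fin 4) := hk4.le.trans hkn
    nlinarith

end ThreeGraph

theorem theorem9p3 :
    ThreeGraph.MemFactorClass ThreeGraph.QuasiNotion.cherry ThreeGraph.K4Minus ∧
      ¬ ThreeGraph.MemFactorClass ThreeGraph.QuasiNotion.edge ThreeGraph.K4Minus :=
  ⟨ThreeGraph.memFactorClass_cherry_k4Minus, ThreeGraph.not_memFactorClass_edge_k4Minus⟩
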